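/- **Setting.** Let $\mathbb D$ be the open unit disk and $H^2=H^2(\mathbb D^2)$ the Hardy space of the bidisk: the holomorphic functions $f(z)=\sum_{m,n\ge 0}a_{mn}z_1^mz_2^n$ on $\mathbb D^2$ with $\|f\|^2=\sum|a_{mn}|^2<\infty$. For $j=1,2$ let $M_{z_j}$ be multiplication by $z_j$ on $H^2$ and $M_{z_j}^*$ its adjoint (the backward shift). Let $\phi$ be a two-variable inner function, that is, $\phi$ is holomorphic on $\mathbb D^2$, $|\phi|\le 1$ there, and $\lim_{r\nearrow 1}|\phi(r\tau)|=1$ for almost every $\tau\in\mathbb T^2$. Then $\phi \in H^2$. Put - $\mathcal K_\phi=H^2\ominus\phi H^2$; - $S_1^{\max}$ = the largest subspace of $\mathcal K_\phi$ invariant under $M_{z_1}$, and $S_2^{\min}=\mathcal K_\phi\ominus S_1^{\max}$; - $\mathcal H(K_1^{\max})=S_1^{\max}\ominus z_1S_1^{\max}$ and $\mathcal H(K_2^{\min})=S_2^{\min}\ominus z_2S_2^{\min}$, with reproducing kernels $K_1^{\max},K_2^{\min}$; write $k_{1,w}^{\max}=K_1^{\max}(\cdot,w)$ and $k_{2,w}^{\min}=K_2^{\min}(\cdot,w)$;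 - $P_1,P_2$ = the orthogonal projections of $H^2$ onto $\mathcal H(K_1^{\max})$, $\mathcal H(K_2^{\min})$; - $\mathcal H_\phi=\mathcal H(K_2^{\min})\oplus\mathcal H(K_1^{\max})$, with elements written $\begin{bmatrix}f_1\\ f_2\end{bmatrix}$, $f_1\in\mathcal H(K_2^{\min})$, $f_2\in\mathcal H(K_1^{\max})$, and, for $z\in\mathbb D^2$, $E_z\begin{bmatrix}f_1\\ f_2\end{bmatrix}=\begin{bmatrix}z_1f_1\\ z_2f_2\end{bmatrix}$. **Theorem 2.1.** There is a unique linear isometry $V$ of $\mathbb C\oplus\mathcal H_\phi$ into itself such that $$V\begin{bmatrix}1\\ \overline{w_1}\,k_{2,w}^{\min}\\ \overline{w_2}\,k_{1,w}^{\max}\end{bmatrix}=\begin{bmatrix}\overline{\phi(w)}\\ k_{2,w}^{\min}\\ k_{1,w}^{\max}\end{bmatrix}\qquad\text{for all } w\in\mathbb D^2 .$$ Write $V^*=\begin{bmatrix}A&B\\ C&D\end{bmatrix}$ as a block operator on $\mathbb C\oplus\mathcal H_\phi$. Then, for all $z\in\mathbb D^2$, $1-E_zD$ is invertible and $\phi(z)=A+B(1-E_zD)^{-1}E_zC$.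 Moreover, for all $x\in\mathbb C$ and all $\begin{bmatrix}f_1\\ f_2\end{bmatrix}\in\mathcal H_\phi$, 1. $Ax=\phi(0)x$; 2. $B\begin{bmatrix}f_1\\ f_2\end{bmatrix}=(f_1+f_2)(0)$; 3. $Cx=\begin{bmatrix}P_2M_{z_1}^*\phi\\ P_1M_{z_2}^*\phi\end{bmatrix}x$; 4. $D\begin{bmatrix}f_1\\ f_2\end{bmatrix}=\begin{bmatrix}P_2M_{z_1}^*(f_1+f_2)\\ P_1M_{z_2}^*(f_1+f_2)\end{bmatrix}$. -/

import Mathlib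

open scoped ComplexConjugate Topology Complex.UnitDisc
open Filter MeasureTheory

noncomputable section

namespace BidiskInner

/-- The open bidisk. -/
abbrev Bidisk : Type := 𝔻 × 𝔻

/-- A point of the bidisk as a point of `ℂ × ℂ`. -/
def Bidisk.toProd (z : Bidisk) : ℂ × ℂ := ((z.1 : ℂ), (z.2 : ℂ))

/-- A two-variable inner function: a holomorphic function on the bidisk, bounded by `1`, whose
radial limits have modulus `1` at almost every point of the torus. Only the values on the bidisk
matter. -/
structure IsInner (φ : ℂ × ℂ → ℂ) : Prop where
  differentiableOn : DifferentiableOn ℂ φ (Metric.ball (0 : ℂ) 1 ×ˢ Metric.ball (0 : ℂ) 1)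
  norm_le_one : ∀ z : Bidisk, ‖φ z.toProd‖ ≤ 1
  radial : ∀ᵐ θ : ℝ × ℝ, Tendsto
    (fun r : ℝ => ‖φ ((r : ℂ) * Complex.exp (θ.1 * Complex.I),
      (r : ℂ) * Complex.exp (θ.2 * Complex.I))‖) (𝓝[<] 1) (𝓝 1)

/-! ### The Hardy space of the bidisk -/

/-- The Hardy space `H²(𝔻²)`: an element is given by its square summable family of Taylor
coefficients `a m n`; the function it stands for is `z ↦ ∑ a m n * z₁ ^ m * z₂ ^ n`
(see `HardySpace.hasSum_apply`), and different elements are different functions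
(see the instance of `RKHS`). -/
def HardySpace : Type := lp (fun _ : ℕ × ℕ => ℂ) 2

instance : NormedAddCommGroup HardySpace :=
  inferInstanceAs (NormedAddCommGroup (lp (fun _ : ℕ × ℕ => ℂ) 2))

instance : InnerProductSpace ℂ HardySpace :=
  inferInstanceAs (InnerProductSpace ℂ (lp (fun _ : ℕ × ℕ => ℂ) 2))

instance : CompleteSpace HardySpace :=
  inferInstanceAs (CompleteSpace (lp (fun _ : ℕ × ℕ => ℂ) 2))

namespace HardySpace

/-- The family of Taylor coefficients. -/
def coeff (f : HardySpace) : ℕ × ℕ → ℂ := Subtype.val (p := fun x => x ∈ lp (fun _ : ℕ × ℕ => ℂ) 2) f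

/-- The element with given Taylor coefficients. -/
def mk (a : ℕ × ℕ → ℂ) (ha : Memℓp a 2) : HardySpace :=
  (⟨a, ha⟩ : lp (fun _ : ℕ × ℕ => ℂ) 2)

theorem coeff_mk (a : ℕ × ℕ → ℂ) (ha : Memℓp a 2) : (mk a ha).coeff = a := rfl

theorem ext_coeff {f g : HardySpace} (h : f.coeff = g.coeff) : f = g := Subtype.ext h

theorem coeff_add (f g : HardySpace) : (f + g).coeff = f.coeff + g.coeff := rfl

theorem coeff_smul (c : ℂ) (f : HardySpace) : (c • f).coeff = c • f.coeff := rfl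

theorem memℓp_coeff (f : HardySpace) : Memℓp f.coeff 2 :=
  Subtype.property (p := fun x => x ∈ lp (fun _ : ℕ × ℕ => ℂ) 2) f

theorem norm_sq_eq (f : HardySpace) : ‖f‖ ^ 2 = ∑' p, ‖f.coeff p‖ ^ 2 := by
  have h := lp.norm_rpow_eq_tsum (p := 2) (by norm_num) (show lp (fun _ : ℕ × ℕ => ℂ) 2 from f)
  simpa using (show ‖f‖ ^ (2 : ENNReal).toReal = ∑' p, ‖f.coeff p‖ ^ (2 : ENNReal).toReal from h)

theorem hasSum_inner (f g : HardySpace) :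
    HasSum (fun p => inner ℂ (f.coeff p) (g.coeff p)) (inner ℂ f g) :=
  lp.hasSum_inner (𝕜 := ℂ) (G := fun _ : ℕ × ℕ => ℂ) f g

theorem summable_pow (z : Bidisk) :
    Summable fun p : ℕ × ℕ => ‖conj ((z.1 : ℂ) ^ p.1 * (z.2 : ℂ) ^ p.2)‖ ^ (2 : ℝ) := by
  have h : ∀ x : 𝔻, Summable fun n : ℕ => (‖(x : ℂ)‖ ^ 2) ^ n := fun x =>
    summable_geometric_of_lt_one (by positivity)
      (by simpa using pow_lt_one₀ (norm_nonneg _) x.norm_lt_one two_ne_zero)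
  refine ((h z.1).mul_of_nonneg (h z.2) (fun _ => by positivity) (fun _ => by positivity)).congr ?_
  intro p
  simp only [map_mul, map_pow, norm_mul, norm_pow, RCLike.norm_conj, Real.rpow_two]
  ring

/-- The element of the Hardy space that represents evaluation at `z`, with Taylor coefficients
`conj (z₁ ^ m * z₂ ^ n)`. -/
def szego (z : Bidisk) : HardySpace :=
  mk (fun p => conj ((z.1 : ℂ) ^ p.1 * (z.2 : ℂ) ^ p.2))
    (memℓp_gen (by simpa using summable_pow z))

theorem hasSum_inner_szego (f : HardySpace) (z : Bidisk) :
    HasSum (fun p : ℕ × ℕ => f.coeff p * ((z.1 : ℂ) ^ p.1 * (z.2 : ℂ) ^ p.2))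
      (inner ℂ (szego z) f) := by
  refine (hasSum_inner (szego z) f).congr_fun ?_
  intro p
  simp [szego, coeff_mk]

/-- A one-variable power series that vanishes on the disk has zero coefficients. -/
theorem eq_zero_of_hasSum_pow {a : ℕ → ℂ} (h : ∀ z : 𝔻, HasSum (fun n => a n * (z : ℂ) ^ n) 0) :
    a = 0 := by
  have hp : HasFPowerSeriesAt (fun _ : ℂ => (0 : ℂ)) (FormalMultilinearSeries.ofScalars ℂ a) 0 := by
    rw [hasFPowerSeriesAt_iff]
    filter_upwards [Metric.ball_mem_nhds (0 : ℂ) one_pos] with z hz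
    have h1 := h (Complex.UnitDisc.mk z (by simpa using hz))
    simpa [mul_comm] using h1
  have h0 := hp.eq_zero
  funext n
  have h1 : (FormalMultilinearSeries.ofScalars ℂ a).coeff n = 0 := by
    rw [h0]
    rfl
  rwa [FormalMultilinearSeries.coeff_ofScalars] at h1

theorem coeff_eq_zero_of_inner_szego {f : HardySpace} (h : ∀ z, inner ℂ (szego z) f = 0) :
    f.coeff = 0 := by
  have h1 : ∀ z : Bidisk, HasSum
      (fun p : ℕ × ℕ => f.coeff p * ((z.1 : ℂ) ^ p.1 * (z.2 : ℂ) ^ p.2)) 0 := fun z => by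
    simpa [h z] using hasSum_inner_szego f z
  have h2 : ∀ (w : 𝔻) (m : ℕ), HasSum (fun n => f.coeff (m, n) * (w : ℂ) ^ n) 0 := by
    intro w
    have hr : ∀ m : ℕ, Summable fun n => f.coeff (m, n) * (w : ℂ) ^ n := by
      intro m
      have hw : ‖(w : ℂ)‖ < 1 := w.norm_lt_one
      obtain ⟨r, hr0, hr1⟩ : ∃ r : 𝔻, (r : ℂ) ≠ 0 ∧ (r : ℂ) ≠ 1 :=
        ⟨Complex.UnitDisc.mk (1 / 2) (by norm_num), by simp, by simp⟩
      have h3 := (h1 (r, w)).summable.comp_injective (Prod.mk_right_injective m)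
      refine ((h3.mul_left (((r : ℂ) ^ m)⁻¹))).congr ?_
      intro n
      simp only [Function.comp]
      field_simp
    have h4 : (fun m => ∑' n, f.coeff (m, n) * (w : ℂ) ^ n) = 0 := by
      refine eq_zero_of_hasSum_pow fun z => ?_
      refine (h1 (z, w)).prod_fiberwise fun m => ?_
      have h5 := ((hr m).hasSum).mul_right ((z : ℂ) ^ m)
      refine h5.congr_fun ?_
      intro n
      ring
    intro m
    have h6 := (hr m).hasSum
    rwa [show ∑' n, f.coeff (m, n) * (w : ℂ) ^ n = 0 from congrFun h4 m] at h6
  funext p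
  exact congrFun (eq_zero_of_hasSum_pow fun w => h2 w p.1) p.2

/-- The Hardy space is a reproducing kernel Hilbert space of functions on the bidisk. -/
instance : RKHS ℂ HardySpace Bidisk ℂ where
  coeCLM := ContinuousLinearMap.pi fun z => innerSL ℂ (szego z)
  coeCLM_injective := by
    refine (injective_iff_map_eq_zero _).mpr fun f hf => ?_
    exact ext_coeff (coeff_eq_zero_of_inner_szego fun z => congrFun hf z)

theorem apply_eq_inner (f : HardySpace) (z : Bidisk) : f z = inner ℂ (szego z) f := rfl

theorem hasSum_apply (f : HardySpace) (z : Bidisk) :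
    HasSum (fun p : ℕ × ℕ => f.coeff p * ((z.1 : ℂ) ^ p.1 * (z.2 : ℂ) ^ p.2)) (f z) :=
  hasSum_inner_szego f z

/-- Transport of Taylor coefficients along an injective map of the exponents, as an isometry. -/
def shift (e : ℕ × ℕ → ℕ × ℕ) (he : Function.Injective e) : HardySpace →ₗᵢ[ℂ] HardySpace where
  toFun f := mk (Function.extend e f.coeff 0) (by
    refine memℓp_gen ?_
    have h := (memℓp_gen_iff (p := 2) (by norm_num)).1 f.memℓp_coeff
    refine (he.summable_iff ?_).1 ?_
    · intro x hx
      rw [Function.extend_apply' _ _ _ (by simpa using hx)]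
      simp
    · simpa [Function.comp_def, he.extend_apply] using h)
  map_add' f g := by
    refine ext_coeff ?_
    change Function.extend e (f.coeff + g.coeff) 0 =
      Function.extend e f.coeff 0 + Function.extend e g.coeff 0
    simpa using Function.extend_add e f.coeff g.coeff (0 : ℕ × ℕ → ℂ) 0
  map_smul' c f := by
    refine ext_coeff ?_
    change Function.extend e (c • f.coeff) 0 = c • Function.extend e f.coeff 0
    simpa using Function.extend_smul c e f.coeff (0 : ℕ × ℕ → ℂ)
  norm_map' f := by
    refine (pow_left_inj₀ (norm_nonneg _) (norm_nonneg _) two_ne_zero).1 ?_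
    · rw [norm_sq_eq, norm_sq_eq]
      change ∑' p, ‖Function.extend e f.coeff 0 p‖ ^ 2 = _
      rw [← he.tsum_eq (f := fun p => ‖Function.extend e f.coeff 0 p‖ ^ 2)]
      · simp [he.extend_apply]
      · intro x hx
        by_contra hne
        rw [Function.mem_support, Function.extend_apply' _ _ _ (by simpa using hne)] at hx
        simp at hx

theorem shift_apply (e : ℕ × ℕ → ℕ × ℕ) (he : Function.Injective e) (f : HardySpace) (z : Bidisk) :
    HasSum (fun p : ℕ × ℕ => f.coeff p * ((z.1 : ℂ) ^ (e p).1 * (z.2 : ℂ) ^ (e p).2))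
      (shift e he f z) := by
  have h := hasSum_apply (shift e he f) z
  rw [← he.hasSum_iff] at h
  · refine h.congr_fun ?_
    intro p
    simp [shift, coeff_mk, he.extend_apply]
  · intro x hx
    have h0 : (shift e he f).coeff x = 0 :=
      Function.extend_apply' f.coeff (0 : ℕ × ℕ → ℂ) x (by simpa only [Set.mem_range] using hx)
    rw [h0, zero_mul]

end HardySpace

open HardySpace

theorem injective_succ1 : Function.Injective fun p : ℕ × ℕ => (p.1 + 1, p.2) := fun p q h => by
  simp only [Prod.mk.injEq, add_left_inj] at h
  exact Prod.ext h.1 h.2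

theorem injective_succ2 : Function.Injective fun p : ℕ × ℕ => (p.1, p.2 + 1) := fun p q h => by
  simp only [Prod.mk.injEq, add_left_inj] at h
  exact Prod.ext h.1 h.2

/-- Multiplication by `z₁` on the Hardy space. -/
def M₁ : HardySpace →L[ℂ] HardySpace :=
  (shift (fun p => (p.1 + 1, p.2)) injective_succ1).toContinuousLinearMap

/-- Multiplication by `z₂` on the Hardy space. -/
def M₂ : HardySpace →L[ℂ] HardySpace :=
  (shift (fun p => (p.1, p.2 + 1)) injective_succ2).toContinuousLinearMap

theorem M₁_apply (f : HardySpace) (z : Bidisk) : M₁ f z = z.1 * f z := by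
  refine (shift_apply _ injective_succ1 f z).unique ?_
  refine ((hasSum_apply f z).mul_left (z.1 : ℂ)).congr_fun ?_
  intro p
  simp only [pow_succ]
  ring

theorem M₂_apply (f : HardySpace) (z : Bidisk) : M₂ f z = z.2 * f z := by
  refine (shift_apply _ injective_succ2 f z).unique ?_
  refine ((hasSum_apply f z).mul_left (z.2 : ℂ)).congr_fun ?_
  intro p
  simp only [pow_succ]
  ring

/-! ### The canonical model spaces -/

/-- The subspace `φ H²`. -/
def range (φ : ℂ × ℂ → ℂ) : Submodule ℂ HardySpace where
  carrier := {g | ∃ h : HardySpace, ∀ z : Bidisk, g z = φ z.toProd * h z}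
  add_mem' := by
    rintro _ _ ⟨h, hh⟩ ⟨k, hk⟩
    exact ⟨h + k, fun z => by simp [hh z, hk z, mul_add]⟩
  zero_mem' := ⟨0, fun z => by simp⟩
  smul_mem' := by
    rintro c _ ⟨h, hh⟩
    exact ⟨c • h, fun z => by simp [hh z, mul_left_comm]⟩

/-- `K_φ = H² ⊖ φ H²`. -/
def modelSpace (φ : ℂ × ℂ → ℂ) : Submodule ℂ HardySpace := (range φ)ᗮ

/-- `S₁^max`, the largest subspace of `K_φ` that is invariant under multiplication by `z₁`
(see `isGreatest_S₁max`). -/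
def S₁max (φ : ℂ × ℂ → ℂ) : Submodule ℂ HardySpace :=
  sSup {S | S ≤ modelSpace φ ∧ ∀ f ∈ S, M₁ f ∈ S}

/-- `S₂^min = K_φ ⊖ S₁^max`. -/
def S₂min (φ : ℂ × ℂ → ℂ) : Submodule ℂ HardySpace := modelSpace φ ⊓ (S₁max φ)ᗮ

/-- `H(K₁^max) = S₁^max ⊖ z₁ S₁^max`. -/
def K₁max (φ : ℂ × ℂ → ℂ) : Submodule ℂ HardySpace :=
  S₁max φ ⊓ ((S₁max φ).map (M₁ : HardySpace →ₗ[ℂ] HardySpace))ᗮ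

/-- `H(K₂^min) = S₂^min ⊖ z₂ S₂^min`. -/
def K₂min (φ : ℂ × ℂ → ℂ) : Submodule ℂ HardySpace :=
  S₂min φ ⊓ ((S₂min φ).map (M₂ : HardySpace →ₗ[ℂ] HardySpace))ᗮ

theorem isGreatest_S₁max (φ : ℂ × ℂ → ℂ) :
    IsGreatest {S : Submodule ℂ HardySpace | S ≤ modelSpace φ ∧ ∀ f ∈ S, M₁ f ∈ S} (S₁max φ) := by
  refine ⟨⟨sSup_le fun S hS => hS.1, ?_⟩, fun S hS => le_sSup hS⟩
  have h : S₁max φ ≤ (S₁max φ).comap (M₁ : HardySpace →ₗ[ℂ] HardySpace) :=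
    sSup_le fun S hS f hf => le_sSup hS (hS.2 f hf)
  exact fun f hf => h hf

theorem isClosed_S₁max (φ : ℂ × ℂ → ℂ) : IsClosed (S₁max φ : Set HardySpace) := by
  have h : (S₁max φ).topologicalClosure ≤ S₁max φ := by
    refine (isGreatest_S₁max φ).2 ⟨?_, ?_⟩
    · exact Submodule.topologicalClosure_minimal _ (isGreatest_S₁max φ).1.1
        (Submodule.isClosed_orthogonal _)
    · intro f hf
      exact map_mem_closure M₁.continuous hf fun g hg => (isGreatest_S₁max φ).1.2 g hg
  rw [← le_antisymm h (Submodule.le_topologicalClosure _)]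
  exact Submodule.isClosed_topologicalClosure _

instance (φ : ℂ × ℂ → ℂ) : CompleteSpace (K₁max φ) :=
  ((isClosed_S₁max φ).inter (Submodule.isClosed_orthogonal _)).completeSpace_coe

instance (φ : ℂ × ℂ → ℂ) : CompleteSpace (K₂min φ) :=
  (((Submodule.isClosed_orthogonal _).inter (Submodule.isClosed_orthogonal _)).inter
    (Submodule.isClosed_orthogonal _)).completeSpace_coe

/-- A subspace of the Hardy space is a reproducing kernel Hilbert space of functions on the
bidisk. -/
instance (S : Submodule ℂ HardySpace) : RKHS ℂ S Bidisk ℂ where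
  coeCLM := (RKHS.coeCLM ℂ : HardySpace →L[ℂ] Bidisk → ℂ) ∘L S.subtypeL
  coeCLM_injective := RKHS.coeCLM_injective.comp Subtype.val_injective

theorem coe_submodule_apply (S : Submodule ℂ HardySpace) (f : S) (z : Bidisk) :
    f z = (f : HardySpace) z := rfl

/-- The function `k_{1,w}^max = K₁^max(·, w)`, where `K₁^max` is the reproducing kernel of
`H(K₁^max)`. -/
def k₁max (φ : ℂ × ℂ → ℂ) (w : Bidisk) : K₁max φ := RKHS.kerFun (K₁max φ) w 1

/-- The function `k_{2,w}^min = K₂^min(·, w)`, where `K₂^min` is the reproducing kernel of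
`H(K₂^min)`. -/
def k₂min (φ : ℂ × ℂ → ℂ) (w : Bidisk) : K₂min φ := RKHS.kerFun (K₂min φ) w 1

/-- The orthogonal projection `P₁` of `H²` onto `H(K₁^max)`. -/
def P₁ (φ : ℂ × ℂ → ℂ) : HardySpace →L[ℂ] K₁max φ := (K₁max φ).orthogonalProjectionOnto

/-- The orthogonal projection `P₂` of `H²` onto `H(K₂^min)`. -/
def P₂ (φ : ℂ × ℂ → ℂ) : HardySpace →L[ℂ] K₂min φ := (K₂min φ).orthogonalProjectionOnto

/-! ### The canonical realization -/

/-- The Hilbert space `H_φ = H(K₂^min) ⊕ H(K₁^max)`, with columns `(f₁, f₂)`. -/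
abbrev H (φ : ℂ × ℂ → ℂ) : Type := WithLp 2 (K₂min φ × K₁max φ)

/-- The Hilbert space `ℂ ⊕ H_φ`. -/
abbrev ColumnSpace (φ : ℂ × ℂ → ℂ) : Type := WithLp 2 (ℂ × H φ)

/-- The column `(f₁, f₂)` of `H_φ`. -/
def H.col {φ : ℂ × ℂ → ℂ} (f₁ : K₂min φ) (f₂ : K₁max φ) : H φ := WithLp.toLp 2 (f₁, f₂)

/-- The column `(x, f)` of `ℂ ⊕ H_φ`. -/
def ColumnSpace.col {φ : ℂ × ℂ → ℂ} (x : ℂ) (f : H φ) : ColumnSpace φ := WithLp.toLp 2 (x, f)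

/-- The isometry `V` is the one of the lurking isometry argument for `φ`:
it maps `(1, conj w₁ k_{2,w}^min, conj w₂ k_{1,w}^max)` to
`(conj φ(w), k_{2,w}^min, k_{1,w}^max)` for all `w` in the bidisk. -/
def IsLurkingIsometry (φ : ℂ × ℂ → ℂ) (V : ColumnSpace φ →ₗᵢ[ℂ] ColumnSpace φ) : Prop :=
  ∀ w : Bidisk,
    V (ColumnSpace.col 1 (H.col (conj (w.1 : ℂ) • k₂min φ w) (conj (w.2 : ℂ) • k₁max φ w))) =
      ColumnSpace.col (conj (φ w.toProd)) (H.col (k₂min φ w) (k₁max φ w))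

section Blocks

variable {E F : Type*} [NormedAddCommGroup E] [InnerProductSpace ℂ E] [NormedAddCommGroup F]
  [InnerProductSpace ℂ F]

/-- The inclusion `x ↦ (x, 0)` of the first summand. -/
def inl (E F : Type*) [NormedAddCommGroup E] [InnerProductSpace ℂ E] [NormedAddCommGroup F]
    [InnerProductSpace ℂ F] : E →L[ℂ] WithLp 2 (E × F) :=
  (WithLp.prodContinuousLinearEquiv 2 ℂ E F).symm.toContinuousLinearMap ∘L
    ContinuousLinearMap.inl ℂ E F

/-- The inclusion `y ↦ (0, y)` of the second summand. -/
def inr (E F : Type*) [NormedAddCommGroup E] [InnerProductSpace ℂ E] [NormedAddCommGroup F]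
    [InnerProductSpace ℂ F] : F →L[ℂ] WithLp 2 (E × F) :=
  (WithLp.prodContinuousLinearEquiv 2 ℂ E F).symm.toContinuousLinearMap ∘L
    ContinuousLinearMap.inr ℂ E F

/-- The block `A` of `U = [A B; C D]` on `E ⊕ F`. -/
def blockA (U : WithLp 2 (E × F) →L[ℂ] WithLp 2 (E × F)) : E →L[ℂ] E :=
  WithLp.fstL 2 ℂ E F ∘L U ∘L inl E F

/-- The block `B` of `U = [A B; C D]` on `E ⊕ F`. -/
def blockB (U : WithLp 2 (E × F) →L[ℂ] WithLp 2 (E × F)) : F →L[ℂ] E :=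
  WithLp.fstL 2 ℂ E F ∘L U ∘L inr E F

/-- The block `C` of `U = [A B; C D]` on `E ⊕ F`. -/
def blockC (U : WithLp 2 (E × F) →L[ℂ] WithLp 2 (E × F)) : E →L[ℂ] F :=
  WithLp.sndL 2 ℂ E F ∘L U ∘L inl E F

/-- The block `D` of `U = [A B; C D]` on `E ⊕ F`. -/
def blockD (U : WithLp 2 (E × F) →L[ℂ] WithLp 2 (E × F)) : F →L[ℂ] F :=
  WithLp.sndL 2 ℂ E F ∘L U ∘L inr E F

end Blocks

/-- The operator `V^*` on `ℂ ⊕ H_φ`. -/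
def adj {φ : ℂ × ℂ → ℂ} (V : ColumnSpace φ →ₗᵢ[ℂ] ColumnSpace φ) :
    ColumnSpace φ →L[ℂ] ColumnSpace φ :=
  ContinuousLinearMap.adjoint V.toContinuousLinearMap

/-- The operator `E_z (f₁, f₂) = (z₁ f₁, z₂ f₂)` on `H_φ`. -/
def Ez (φ : ℂ × ℂ → ℂ) (z : Bidisk) : H φ →L[ℂ] H φ :=
  (z.1 : ℂ) • (inl (K₂min φ) (K₁max φ) ∘L WithLp.fstL 2 ℂ (K₂min φ) (K₁max φ)) +
    (z.2 : ℂ) • (inr (K₂min φ) (K₁max φ) ∘L WithLp.sndL 2 ℂ (K₂min φ) (K₁max φ))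

end BidiskInner

end

open BidiskInner

noncomputable section

namespace BidiskInner

/-! The theorem is a lurking isometry argument resting on the Agler decomposition 1 - φ(z) conj φ(w)
= (1 - z₂ conj w₂) K₁(z, w) + (1 - z₁ conj w₁) K₂(z, w), with K₁ and K₂ the two canonical kernels.
Multiplication by φ is an isometry M of H² (`IsInner.exists_mul`): the squared mean of φq over the
torus of radius r tends to that of q, first for entire q, then for all of H² by density. Hence K_φ =
ker M^*, and the projection of the Szegő kernel s_w to K_φ is s_w - conj φ(w) M s_w. The crucial
fact is that S₂^min is invariant under z₂ (`M₂_mem_S₂min`). Splitting the projection of s_w along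
S₁^max and S₂^min, and passing to the wandering subspaces of z₁ and z₂, then gives
`agler_decomposition`. The decomposition says that the columns prescribed for V and their images
have equal Gram matrices, so V exists on the closed span of the former. That span is everything,
because z₁f₁ + z₂f₂ = 0 forces f₁ = f₂ = 0 (`eq_zero_of_M₁_add_M₂_eq_zero`); hence V is defined
everywhere and unique. Pairing with the columns turns V^*(x, f) = (y, g) into the identity of
functions y + z₁g₁ + z₂g₂ = φx + f₁ + f₂. Its value at 0 gives y, and backward shifts followed by P₂
and P₁ recover g₁ and g₂ (`projections_of_eq`). Choosing f = E_z g in the same identity makes g and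
f cancel at z and leaves the formula for φ(z). -/

/-! ### Integration over the torus -/

/-- The point of the unit circle with argument `θ`. -/
def unitExp (θ : ℝ) : ℂ := Complex.exp (θ * Complex.I)

@[simp] theorem norm_unitExp (θ : ℝ) : ‖unitExp θ‖ = 1 := Complex.norm_exp_ofReal_mul_I θ

@[fun_prop] theorem continuous_unitExp : Continuous unitExp := by
  unfold unitExp
  fun_prop

theorem unitExp_ne_zero (θ : ℝ) : unitExp θ ≠ 0 := Complex.exp_ne_zero _

/-- The normalised Lebesgue measure on an interval of length `2π`. -/
def circleMeasure : Measure ℝ :=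
  (ENNReal.ofReal (2 * Real.pi))⁻¹ • volume.restrict (Set.Ioc 0 (2 * Real.pi))

instance : IsProbabilityMeasure circleMeasure := ⟨by
  have h : ENNReal.ofReal (2 * Real.pi) ≠ 0 := by
    simpa using Real.pi_pos
  simp [circleMeasure, -ENNReal.ofReal_mul, ENNReal.inv_mul_cancel h]⟩

theorem circleMeasure_absolutelyContinuous : circleMeasure ≪ volume :=
  (Measure.absolutelyContinuous_of_le Measure.restrict_le_self).smul_left _

theorem integral_circleMeasure (f : ℝ → ℂ) :
    ∫ θ, f θ ∂circleMeasure = (2 * Real.pi)⁻¹ • ∫ θ in 0..2 * Real.pi, f θ := by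
  rw [circleMeasure, integral_smul_measure,
    intervalIntegral.integral_of_le (by positivity), ENNReal.toReal_inv,
    ENNReal.toReal_ofReal (by positivity)]

/-- The normalised Lebesgue measure on the torus, in terms of arguments. -/
abbrev torusMeasure : Measure (ℝ × ℝ) := circleMeasure.prod circleMeasure

theorem torusMeasure_absolutelyContinuous : torusMeasure ≪ volume :=
  circleMeasure_absolutelyContinuous.prod circleMeasure_absolutelyContinuous

theorem integrable_torusMeasure {E : Type*} [NormedAddCommGroup E] {f : ℝ × ℝ → E}
    (hf : AEStronglyMeasurable f torusMeasure) {C : ℝ} (h : ∀ θ, ‖f θ‖ ≤ C) :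
    Integrable f torusMeasure :=
  Integrable.of_bound hf C (.of_forall h)

theorem integral_unitExp_pow (m n : ℕ) :
    ∫ θ, conj (unitExp θ ^ m) * unitExp θ ^ n ∂circleMeasure = if m = n then 1 else 0 := by
  have h1 : ∀ θ : ℝ, conj (unitExp θ ^ m) * unitExp θ ^ n =
      Complex.exp ((((n : ℂ) - m) * Complex.I) * θ) := fun θ => by
    rw [unitExp, ← Complex.exp_nat_mul, ← Complex.exp_nat_mul, ← Complex.exp_conj,
      ← Complex.exp_add]
    congr 1
    simp only [map_mul, map_natCast, Complex.conj_ofReal, Complex.conj_I]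
    ring
  simp_rw [h1]
  split_ifs with h
  · simp [h]
  · have h2 : ((n : ℂ) - m) * Complex.I ≠ 0 :=
      mul_ne_zero (sub_ne_zero.2 (by exact_mod_cast Ne.symm h)) Complex.I_ne_zero
    rw [integral_circleMeasure, integral_exp_mul_complex h2]
    have h3 : Complex.exp (((n : ℂ) - m) * Complex.I * ((2 * Real.pi : ℝ) : ℂ)) = 1 := by
      rw [Complex.exp_eq_one_iff]
      refine ⟨(n : ℤ) - m, ?_⟩
      push_cast
      ring
    rw [h3]
    simp

/-- The characters of the torus with nonnegative frequencies. -/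
def character (p : ℕ × ℕ) (θ : ℝ × ℝ) : ℂ := unitExp θ.1 ^ p.1 * unitExp θ.2 ^ p.2

@[simp] theorem norm_character (p : ℕ × ℕ) (θ : ℝ × ℝ) : ‖character p θ‖ = 1 := by
  simp [character]

@[fun_prop] theorem continuous_character (p : ℕ × ℕ) : Continuous (character p) := by
  unfold character
  fun_prop

theorem integral_character (p q : ℕ × ℕ) :
    ∫ θ, conj (character p θ) * character q θ ∂torusMeasure = if p = q then 1 else 0 := by
  have h : ∀ θ : ℝ × ℝ, conj (character p θ) * character q θ =
      (conj (unitExp θ.1 ^ p.1) * unitExp θ.1 ^ q.1) *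
        (conj (unitExp θ.2 ^ p.2) * unitExp θ.2 ^ q.2) := fun θ => by
    simp only [character, map_mul]
    ring
  simp_rw [h]
  rw [integral_prod_mul (fun x => conj (unitExp x ^ p.1) * unitExp x ^ q.1)
    (fun y => conj (unitExp y ^ p.2) * unitExp y ^ q.2), integral_unitExp_pow,
    integral_unitExp_pow]
  by_cases h1 : p.1 = q.1 <;> by_cases h2 : p.2 = q.2 <;> simp [h1, h2, Prod.ext_iff]

/-- The pointwise expansion of |F|² into a double series, needed for Parseval's identity. -/
theorem hasSum_conj_mul {ι : Type*} {f : ι → ℂ} {s : ℂ} (hf : HasSum f s)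
    (h : Summable fun i => ‖f i‖) :
    HasSum (fun x : ι × ι => conj (f x.1) * f x.2) (conj s * s) := by
  obtain ⟨g, hg⟩ : ∃ g : ι → ℂ, g = fun i => conj (f i) := ⟨_, rfl⟩
  have h1 : HasSum g (conj s) := by rw [hg]; exact Complex.hasSum_conj'.2 hf
  have h2 : Summable fun i => ‖g i‖ := by rw [hg]; simpa using h
  have h3 := h1.mul hf (summable_mul_of_summable_norm h2 h)
  rw [hg] at h3
  exact h3

/-- Parseval's identity for an absolutely convergent Fourier series on the torus. -/
theorem hasSum_norm_sq_of_hasSum_character {c : ℕ × ℕ → ℂ} (hc : Summable fun p => ‖c p‖)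
    {F : ℝ × ℝ → ℂ} (hF : ∀ θ, HasSum (fun p => c p * character p θ) (F θ)) :
    HasSum (fun p => ‖c p‖ ^ 2) (∫ θ, ‖F θ‖ ^ 2 ∂torusMeasure) := by
  obtain ⟨g, hg⟩ : ∃ g : ℕ × ℕ → ℝ × ℝ → ℂ, ∀ p θ, g p θ = c p * character p θ :=
    ⟨_, fun _ _ => rfl⟩
  have hgn : ∀ p θ, ‖g p θ‖ = ‖c p‖ := fun p θ => by simp [hg]
  have hgc : ∀ p, Continuous (g p) := fun p => by
    rw [show g p = fun θ => c p * character p θ from funext (hg p)]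
    fun_prop
  have hcc : Summable fun x : (ℕ × ℕ) × (ℕ × ℕ) => ‖c x.1‖ * ‖c x.2‖ :=
    hc.mul_of_nonneg hc (fun _ => norm_nonneg _) fun _ => norm_nonneg _
  have hnorm : ∀ (x : (ℕ × ℕ) × (ℕ × ℕ)) (θ : ℝ × ℝ),
      ‖conj (g x.1 θ) * g x.2 θ‖ = ‖c x.1‖ * ‖c x.2‖ := by
    intro x θ
    rw [norm_mul, RCLike.norm_conj, hgn, hgn]
  have hpt : ∀ θ, ∑' x : (ℕ × ℕ) × (ℕ × ℕ), conj (g x.1 θ) * g x.2 θ = conj (F θ) * F θ := by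
    intro θ
    have h : HasSum (fun p => g p θ) (F θ) := by simpa only [hg] using hF θ
    exact (hasSum_conj_mul h (by simpa only [hgn] using hc)).tsum_eq
  -- Each term has constant modulus on the torus, so the norms form the product series of ∑ ‖c p‖
  -- with itself and integration term by term is allowed.
  have hsum := hasSum_integral_of_summable_integral_norm (μ := torusMeasure)
    (F := fun (x : (ℕ × ℕ) × (ℕ × ℕ)) θ => conj (g x.1 θ) * g x.2 θ)
    (fun x => integrable_torusMeasure (Continuous.aestronglyMeasurable
      ((Complex.continuous_conj.comp (hgc x.1)).mul (hgc x.2))) fun θ => (hnorm x θ).le)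
    (by simpa only [hnorm, integral_const, probReal_univ, one_smul] using hcc)
  have h1 : ∀ x : (ℕ × ℕ) × (ℕ × ℕ),
      ∫ θ, conj (g x.1 θ) * g x.2 θ ∂torusMeasure =
        conj (c x.1) * c x.2 * if x.1 = x.2 then 1 else 0 := by
    intro x
    rw [← integral_character, ← integral_const_mul]
    refine integral_congr_ae (.of_forall fun θ => ?_)
    simp only [hg, map_mul]
    ring
  simp_rw [h1, hpt] at hsum
  -- By orthogonality of the characters only the diagonal terms survive.
  have hdiag : Function.Injective fun p : ℕ × ℕ => (p, p) := fun p q h => (Prod.mk.inj h).1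
  rw [← hdiag.hasSum_iff] at hsum
  · have h2 : ∀ z : ℂ, conj z * z = ((‖z‖ ^ 2 : ℝ) : ℂ) := fun z => by
      rw [Complex.conj_mul']
      push_cast
      rfl
    simp only [Function.comp_def, if_true, mul_one, h2] at hsum
    rw [integral_complex_ofReal] at hsum
    exact_mod_cast hsum
  · rintro ⟨p, q⟩ hpq
    have : p ≠ q := fun h => hpq ⟨p, by rw [h]⟩
    simp [this]

/-! ### Power series of holomorphic functions on the bidisk -/

/-- The factor is ζ / (ζ - z) with ζ = ρe^{iθ}, the Cauchy kernel with respect to dθ; in this form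
it expands as a geometric series in z / ζ. -/
theorem integral_cauchy {f : ℂ → ℂ} (hf : DifferentiableOn ℂ f (Metric.ball 0 1)) {ρ : ℝ}
    (h0 : 0 < ρ) (h1 : ρ < 1) {z : ℂ} (hz : ‖z‖ < ρ) :
    ∫ θ, (1 - z / (ρ * unitExp θ))⁻¹ * f (ρ * unitExp θ) ∂circleMeasure = f z := by
  have h2 : DiffContOnCl ℂ f (Metric.ball 0 |ρ|) := by
    refine (hf.mono ?_).diffContOnCl
    rw [abs_of_pos h0, closure_ball _ h0.ne']
    exact Metric.closedBall_subset_ball h1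
  rw [← h2.circleAverage_smul_div (w := z) (by simpa [abs_of_pos h0] using hz),
    Real.circleAverage, integral_circleMeasure]
  congr 2
  funext θ
  have h3 : (ρ : ℂ) * unitExp θ ≠ 0 :=
    mul_ne_zero (by exact_mod_cast h0.ne') (unitExp_ne_zero θ)
  have h4 : (ρ : ℂ) * unitExp θ - z ≠ 0 := by
    intro h
    rw [sub_eq_zero] at h
    rw [← h] at hz
    simp [abs_of_pos h0] at hz
  have h5 : 1 - z / (ρ * unitExp θ) = ((ρ : ℂ) * unitExp θ - z) / (ρ * unitExp θ) := by
    rw [sub_div, div_self h3]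
  simp only [circleMap, zero_add, sub_zero, smul_eq_mul]
  rw [h5, inv_div]
  rfl

theorem norm_mul_unitExp {ρ : ℝ} (h0 : 0 ≤ ρ) (θ : ℝ) : ‖(ρ : ℂ) * unitExp θ‖ = ρ := by
  simp [abs_of_nonneg h0]

theorem norm_div_mul_unitExp {ρ : ℝ} (h0 : 0 ≤ ρ) (z : ℂ) (θ : ℝ) :
    ‖z / (ρ * unitExp θ)‖ = ‖z‖ / ρ := by
  rw [norm_div, norm_mul_unitExp h0]

theorem continuous_torus_of_differentiableOn {f : ℂ × ℂ → ℂ}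
    (hf : DifferentiableOn ℂ f (Metric.ball (0 : ℂ) 1 ×ˢ Metric.ball (0 : ℂ) 1)) {ρ : ℝ}
    (h0 : 0 ≤ ρ) (h1 : ρ < 1) :
    Continuous fun θ : ℝ × ℝ => f (ρ * unitExp θ.1, ρ * unitExp θ.2) := by
  refine hf.continuousOn.comp_continuous (by fun_prop) fun θ => ?_
  simp [abs_of_nonneg h0, h1]

theorem exists_bound_torus_of_differentiableOn {f : ℂ × ℂ → ℂ}
    (hf : DifferentiableOn ℂ f (Metric.ball (0 : ℂ) 1 ×ˢ Metric.ball (0 : ℂ) 1)) {ρ : ℝ}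
    (h0 : 0 ≤ ρ) (h1 : ρ < 1) :
    ∃ C, ∀ θ : ℝ × ℝ, ‖f (ρ * unitExp θ.1, ρ * unitExp θ.2)‖ ≤ C := by
  obtain ⟨C, hC⟩ := ((isCompact_closedBall (0 : ℂ) ρ).prod
    (isCompact_closedBall (0 : ℂ) ρ)).exists_bound_of_continuousOn
    (hf.continuousOn.mono (Set.prod_mono (Metric.closedBall_subset_ball h1)
      (Metric.closedBall_subset_ball h1)))
  refine ⟨C, fun θ => hC _ ?_⟩
  simp [abs_of_nonneg h0]

theorem one_sub_ne_zero_of_norm_lt_one {w : ℂ} (h : ‖w‖ < 1) : 1 - w ≠ 0 := by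
  intro h1
  rw [sub_eq_zero] at h1
  simp [← h1] at h

theorem norm_inv_one_sub_le {w : ℂ} {r : ℝ} (h : ‖w‖ ≤ r) (hr : r < 1) :
    ‖(1 - w)⁻¹‖ ≤ (1 - r)⁻¹ := by
  rw [norm_inv]
  have h1 := norm_sub_norm_le (1 : ℂ) w
  rw [norm_one] at h1
  exact inv_anti₀ (by linarith) (by linarith)

theorem continuous_inv_one_sub_div {ρ : ℝ} (h0 : 0 < ρ) {z : ℂ} (hz : ‖z‖ < ρ) :
    Continuous fun θ : ℝ => (1 - z / (ρ * unitExp θ))⁻¹ := by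
  refine Continuous.inv₀ (continuous_const.sub (continuous_const.div (by fun_prop) fun θ =>
    mul_ne_zero (by exact_mod_cast h0.ne') (unitExp_ne_zero θ))) fun θ => ?_
  refine one_sub_ne_zero_of_norm_lt_one ?_
  rw [norm_div_mul_unitExp h0.le]
  exact (div_lt_one h0).2 hz

/-- Cauchy's integral formula on the bidisk. -/
theorem integral_cauchy_bidisk {f : ℂ × ℂ → ℂ}
    (hf : DifferentiableOn ℂ f (Metric.ball (0 : ℂ) 1 ×ˢ Metric.ball (0 : ℂ) 1)) {ρ : ℝ}
    (h0 : 0 < ρ) (h1 : ρ < 1) {z w : ℂ} (hz : ‖z‖ < ρ) (hw : ‖w‖ < ρ) :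
    ∫ θ, (1 - z / (ρ * unitExp θ.1))⁻¹ * ((1 - w / (ρ * unitExp θ.2))⁻¹ *
      f (ρ * unitExp θ.1, ρ * unitExp θ.2)) ∂torusMeasure = f (z, w) := by
  obtain ⟨C, hC⟩ := exists_bound_torus_of_differentiableOn hf h0.le h1
  have hle : ∀ {x : ℂ}, ‖x‖ < ρ → ∀ θ, ‖(1 - x / (ρ * unitExp θ))⁻¹‖ ≤ (1 - ‖x‖ / ρ)⁻¹ :=
    fun hx θ => norm_inv_one_sub_le (norm_div_mul_unitExp h0.le _ θ).le ((div_lt_one h0).2 hx)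
  have hnn : ∀ {x : ℂ}, ‖x‖ < ρ → 0 ≤ (1 - ‖x‖ / ρ)⁻¹ := fun hx =>
    inv_nonneg.2 (sub_nonneg.2 ((div_lt_one h0).2 hx).le)
  have hint : Integrable (fun θ : ℝ × ℝ => (1 - z / (ρ * unitExp θ.1))⁻¹ *
      ((1 - w / (ρ * unitExp θ.2))⁻¹ * f (ρ * unitExp θ.1, ρ * unitExp θ.2))) torusMeasure := by
    refine integrable_torusMeasure (C := (1 - ‖z‖ / ρ)⁻¹ * ((1 - ‖w‖ / ρ)⁻¹ * C))
      (Continuous.aestronglyMeasurable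
        (((continuous_inv_one_sub_div h0 hz).comp continuous_fst).mul
        (((continuous_inv_one_sub_div h0 hw).comp continuous_snd).mul
          (continuous_torus_of_differentiableOn hf h0.le h1)))) fun θ => ?_
    rw [norm_mul, norm_mul]
    exact mul_le_mul (hle hz _) (mul_le_mul (hle hw _) (hC _) (norm_nonneg _) (hnn hw))
      (by positivity) (hnn hz)
  rw [integral_prod _ hint]
  have hin : ∀ x : ℝ, ∫ y, (1 - w / (ρ * unitExp y))⁻¹ *
      f (ρ * unitExp x, ρ * unitExp y) ∂circleMeasure = f (ρ * unitExp x, w) := by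
    intro x
    refine integral_cauchy (f := fun y => f (ρ * unitExp x, y))
      (hf.comp (by fun_prop) fun y hy => ?_) h0 h1 hw
    refine ⟨?_, hy⟩
    simp [abs_of_pos h0, h1]
  simp_rw [integral_const_mul, hin]
  refine integral_cauchy (f := fun x => f (x, w))
    (hf.comp (by fun_prop) fun y hy => ?_) h0 h1 hz
  exact ⟨hy, by simpa using hw.trans h1⟩

/-- Power series expansion on a smaller bidisk. -/
theorem exists_hasSum_of_lt {f : ℂ × ℂ → ℂ}
    (hf : DifferentiableOn ℂ f (Metric.ball (0 : ℂ) 1 ×ˢ Metric.ball (0 : ℂ) 1)) {ρ : ℝ}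
    (h0 : 0 < ρ) (h1 : ρ < 1) :
    ∃ a : ℕ × ℕ → ℂ, ∀ z w : ℂ, ‖z‖ < ρ → ‖w‖ < ρ →
      HasSum (fun p : ℕ × ℕ => a p * (z ^ p.1 * w ^ p.2)) (f (z, w)) := by
  obtain ⟨C, hC⟩ := exists_bound_torus_of_differentiableOn hf h0.le h1
  have hcont := continuous_torus_of_differentiableOn hf h0.le h1
  obtain ⟨F, hF⟩ : ∃ F : ℝ × ℝ → ℂ, ∀ θ, F θ = f (ρ * unitExp θ.1, ρ * unitExp θ.2) :=
    ⟨_, fun _ => rfl⟩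
  simp only [← hF] at hC hcont
  -- The Cauchy coefficients; the series arises by expanding both kernels of
  -- `integral_cauchy_bidisk` and integrating term by term, with a product of geometric series as
  -- majorant.
  refine ⟨fun p => ∫ θ, ((ρ * unitExp θ.1)⁻¹ ^ p.1 * (ρ * unitExp θ.2)⁻¹ ^ p.2) * F θ
    ∂torusMeasure, fun z w hz hw => ?_⟩
  have hρ : ∀ θ : ℝ, (ρ : ℂ) * unitExp θ ≠ 0 := fun θ =>
    mul_ne_zero (by exact_mod_cast h0.ne') (unitExp_ne_zero θ)
  have hlt : ∀ {x : ℂ}, ‖x‖ < ρ → ∀ θ, ‖x / (ρ * unitExp θ)‖ < 1 := fun hx θ => by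
    rw [norm_div_mul_unitExp h0.le]
    exact (div_lt_one h0).2 hx
  have hgeo : ∀ {x : ℂ}, ‖x‖ < ρ → Summable fun n : ℕ => (‖x‖ / ρ) ^ n := fun hx =>
    summable_geometric_of_lt_one (by positivity) ((div_lt_one h0).2 hx)
  have hmaj : Summable fun p : ℕ × ℕ => (‖z‖ / ρ) ^ p.1 * (‖w‖ / ρ) ^ p.2 :=
    (hgeo hz).mul_of_nonneg (hgeo hw) (fun _ => by positivity) fun _ => by positivity
  obtain ⟨G, hG⟩ : ∃ G : ℕ × ℕ → ℝ × ℝ → ℂ, ∀ p θ, G p θ =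
      ((z / (ρ * unitExp θ.1)) ^ p.1 * (w / (ρ * unitExp θ.2)) ^ p.2) * F θ :=
    ⟨_, fun _ _ => rfl⟩
  have hGle : ∀ p θ, ‖G p θ‖ ≤ (‖z‖ / ρ) ^ p.1 * (‖w‖ / ρ) ^ p.2 * C := fun p θ => by
    rw [hG, norm_mul, norm_mul, norm_pow, norm_pow, norm_div_mul_unitExp h0.le,
      norm_div_mul_unitExp h0.le]
    exact mul_le_mul_of_nonneg_left (hC θ) (by positivity)
  have hGint : ∀ p, Integrable (G p) torusMeasure := fun p => by
    refine integrable_torusMeasure (Continuous.aestronglyMeasurable ?_) (hGle p)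
    rw [show G p = _ from funext (hG p)]
    refine Continuous.mul (Continuous.mul (Continuous.pow ?_ _) (Continuous.pow ?_ _)) hcont
    · exact continuous_const.div (by fun_prop) fun θ => hρ _
    · exact continuous_const.div (by fun_prop) fun θ => hρ _
  have hGsum : ∀ θ, ∑' p, G p θ = (1 - z / (ρ * unitExp θ.1))⁻¹ *
      ((1 - w / (ρ * unitExp θ.2))⁻¹ * F θ) := fun θ => by
    have h2 := (hasSum_geometric_of_norm_lt_one (hlt hz θ.1)).mul
      (hasSum_geometric_of_norm_lt_one (hlt hw θ.2))
      (summable_mul_of_summable_norm (summable_norm_geometric_of_norm_lt_one (hlt hz θ.1))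
        (summable_norm_geometric_of_norm_lt_one (hlt hw θ.2)))
    rw [← mul_assoc]
    simp only [hG]
    exact (h2.mul_right (F θ)).tsum_eq
  have hsum := hasSum_integral_of_summable_integral_norm (μ := torusMeasure) hGint (by
    refine (hmaj.mul_right C).of_nonneg_of_le (fun p => integral_nonneg fun _ => norm_nonneg _)
      fun p => ?_
    refine (integral_mono (hGint p).norm (integrable_const _) (hGle p)).trans_eq ?_
    simp)
  simp_rw [hGsum, hF, integral_cauchy_bidisk hf h0 h1 hz hw] at hsum
  refine hsum.congr_fun fun p => ?_
  rw [mul_comm, ← integral_const_mul]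
  refine integral_congr_ae (.of_forall fun θ => ?_)
  simp only [hG, hF, div_eq_mul_inv, mul_pow]
  ring

open HardySpace

/-- Dilating by s = δ / 2 makes the coefficients absolutely summable, hence square summable, so the
uniqueness already known for the Hardy space applies to the dilated series. -/
theorem eq_zero_of_hasSum_zero {a : ℕ × ℕ → ℂ} {δ : ℝ} (hδ : 0 < δ)
    (ha : ∀ z w : ℂ, ‖z‖ < δ → ‖w‖ < δ →
      HasSum (fun p : ℕ × ℕ => a p * (z ^ p.1 * w ^ p.2)) 0) : a = 0 := by
  have h0 : 0 < δ / 2 := by positivity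
  obtain ⟨s, hs, hsn⟩ : ∃ s : ℂ, s ≠ 0 ∧ ‖s‖ = δ / 2 :=
    ⟨(δ / 2 : ℝ), by exact_mod_cast h0.ne', by rw [Complex.norm_real, Real.norm_of_nonneg h0.le]⟩
  have hm : Memℓp (fun p : ℕ × ℕ => a p * (s ^ p.1 * s ^ p.2)) 2 := by
    refine Memℓp.of_exponent_ge (q := 1) (memℓp_gen ?_) one_le_two
    simpa using (ha s s (by linarith) (by linarith)).summable.norm
  have hz : (HardySpace.mk _ hm).coeff = 0 := by
    refine coeff_eq_zero_of_inner_szego fun z => ?_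
    have hlt : ∀ x : 𝔻, ‖s * (x : ℂ)‖ < δ := fun x => by
      rw [norm_mul, hsn]
      nlinarith [x.norm_lt_one, norm_nonneg (x : ℂ)]
    refine (hasSum_inner_szego _ z).unique ((ha _ _ (hlt z.1) (hlt z.2)).congr_fun fun p => ?_)
    rw [coeff_mk, mul_pow, mul_pow]
    ring
  funext p
  have h := congrFun hz p
  rw [coeff_mk] at h
  simpa [hs] using h

/-- A holomorphic function on the bidisk is the sum of a power series. -/
theorem exists_hasSum_bidisk {f : ℂ × ℂ → ℂ}
    (hf : DifferentiableOn ℂ f (Metric.ball (0 : ℂ) 1 ×ˢ Metric.ball (0 : ℂ) 1)) :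
    ∃ a : ℕ × ℕ → ℂ, ∀ z w : ℂ, ‖z‖ < 1 → ‖w‖ < 1 →
      HasSum (fun p : ℕ × ℕ => a p * (z ^ p.1 * w ^ p.2)) (f (z, w)) := by
  obtain ⟨a, ha⟩ := exists_hasSum_of_lt hf (ρ := 1 / 2) (by norm_num) (by norm_num)
  refine ⟨a, fun z w hz hw => ?_⟩
  -- The coefficients come from the radius 1/2. A larger radius reaching the given point yields the
  -- same ones, since both series agree on the bidisk of radius 1/2.
  obtain ⟨ρ, hρ, hρ1⟩ := exists_between (max_lt (max_lt hz hw) (by norm_num : (1 / 2 : ℝ) < 1))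
  rw [max_lt_iff, max_lt_iff] at hρ
  obtain ⟨b, hb⟩ := exists_hasSum_of_lt hf (by linarith : 0 < ρ) hρ1
  have hab : a - b = 0 := by
    refine eq_zero_of_hasSum_zero (δ := 1 / 2) (by norm_num) fun x y hx hy => ?_
    have h := (ha x y hx hy).sub (hb x y (by linarith) (by linarith))
    rw [sub_self] at h
    refine h.congr_fun fun p => ?_
    rw [Pi.sub_apply, sub_mul]
  rw [sub_eq_zero.1 hab]
  exact hb z w hρ.1.1 hρ.1.2

/-! ### Square means and multiplication by an inner function -/

/-- A holomorphic function on the bidisk whose square means converge is in the Hardy space, and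
the limit is the square of its norm. -/
theorem exists_hardySpace_of_tendsto {f : ℂ × ℂ → ℂ}
    (hf : DifferentiableOn ℂ f (Metric.ball (0 : ℂ) 1 ×ˢ Metric.ball (0 : ℂ) 1)) {L : ℝ}
    (hL : Tendsto (fun r : ℝ => ∫ θ, ‖f (r * unitExp θ.1, r * unitExp θ.2)‖ ^ 2 ∂torusMeasure)
      (𝓝[<] 1) (𝓝 L)) :
    ∃ F : HardySpace, (∀ z : Bidisk, F z = f z.toProd) ∧ ‖F‖ ^ 2 = L := by
  obtain ⟨a, ha⟩ := exists_hasSum_bidisk hf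
  have hpars : ∀ r : ℝ, 0 ≤ r → r < 1 → HasSum (fun p : ℕ × ℕ => ‖a p‖ ^ 2 * (r ^ 2) ^ (p.1 + p.2))
      (∫ θ, ‖f (r * unitExp θ.1, r * unitExp θ.2)‖ ^ 2 ∂torusMeasure) := by
    intro r h0 h1
    have hr : ∀ θ : ℝ, ‖(r : ℂ) * unitExp θ‖ < 1 := fun θ => by rwa [norm_mul_unitExp h0]
    have hr1 : ‖(r : ℂ)‖ < 1 := by rwa [Complex.norm_real, Real.norm_of_nonneg h0]
    have h := hasSum_norm_sq_of_hasSum_character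
      (c := fun p => a p * ((r : ℂ) ^ p.1 * (r : ℂ) ^ p.2)) (ha r r hr1 hr1).summable.norm
      (F := fun θ => f (r * unitExp θ.1, r * unitExp θ.2)) fun θ => by
        refine (ha _ _ (hr θ.1) (hr θ.2)).congr_fun fun p => ?_
        simp only [character, mul_pow]
        ring
    refine h.congr_fun fun p => ?_
    rw [norm_mul, norm_mul, norm_pow, norm_pow, Complex.norm_real, Real.norm_of_nonneg h0]
    ring
  have hev : ∀ᶠ r : ℝ in 𝓝[<] 1, 0 ≤ r ∧ r < 1 := by
    filter_upwards [self_mem_nhdsWithin, mem_nhdsWithin_of_mem_nhds (Ioi_mem_nhds one_pos)]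
      with r h1 h2
    exact ⟨le_of_lt h2, h1⟩
  have hterm : ∀ p : ℕ × ℕ, Tendsto (fun r : ℝ => ‖a p‖ ^ 2 * (r ^ 2) ^ (p.1 + p.2)) (𝓝[<] 1)
      (𝓝 (‖a p‖ ^ 2)) := by
    intro p
    have h : Continuous fun r : ℝ => ‖a p‖ ^ 2 * (r ^ 2) ^ (p.1 + p.2) := by fun_prop
    simpa using (h.tendsto 1).mono_left nhdsWithin_le_nhds
  have hsum : Summable fun p => ‖a p‖ ^ 2 := by
    -- Every finite partial sum, damped by powers of r, is at most the square mean; let r tend to 1.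
    refine summable_of_sum_le (c := L) (fun _ => by positivity) fun u => ?_
    refine le_of_tendsto_of_tendsto (tendsto_finsetSum u fun p _ => hterm p) hL ?_
    filter_upwards [hev] with r hr
    exact sum_le_hasSum u (fun _ _ => by positivity) (hpars r hr.1 hr.2)
  have hlim : Tendsto (fun r : ℝ => ∑' p : ℕ × ℕ, ‖a p‖ ^ 2 * (r ^ 2) ^ (p.1 + p.2)) (𝓝[<] 1)
      (𝓝 (∑' p, ‖a p‖ ^ 2)) := by
    refine tendsto_tsum_of_dominated_convergence hsum hterm ?_
    filter_upwards [hev] with r hr p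
    rw [Real.norm_of_nonneg (by positivity)]
    exact mul_le_of_le_one_right (by positivity)
      (pow_le_one₀ (by positivity) (pow_le_one₀ hr.1 hr.2.le))
  have hLeq : ∑' p, ‖a p‖ ^ 2 = L := by
    refine tendsto_nhds_unique (hlim.congr' ?_) hL
    filter_upwards [hev] with r hr
    exact (hpars r hr.1 hr.2).tsum_eq
  refine ⟨HardySpace.mk a (memℓp_gen (by simpa using hsum)), fun z => ?_, ?_⟩
  · refine (hasSum_apply _ z).unique ?_
    rw [coeff_mk]
    exact ha _ _ z.1.norm_lt_one z.2.norm_lt_one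
  · rw [norm_sq_eq, coeff_mk, hLeq]

/-- The product of an inner function and an entire function is in the Hardy space, and its norm
is that of the entire function on the torus. -/
theorem IsInner.exists_mul_entire {φ : ℂ × ℂ → ℂ} (hφ : IsInner φ) {q : ℂ × ℂ → ℂ}
    (hq : Differentiable ℂ q) :
    ∃ F : HardySpace, (∀ z : Bidisk, F z = φ z.toProd * q z.toProd) ∧
      ‖F‖ ^ 2 = ∫ θ, ‖q (unitExp θ.1, unitExp θ.2)‖ ^ 2 ∂torusMeasure := by
  have hd := hφ.differentiableOn.mul hq.differentiableOn
  refine exists_hardySpace_of_tendsto hd ?_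
  obtain ⟨C, hC⟩ := ((isCompact_closedBall (0 : ℂ) 1).prod
    (isCompact_closedBall (0 : ℂ) 1)).exists_bound_of_continuousOn hq.continuous.continuousOn
  have hev : ∀ᶠ r : ℝ in 𝓝[<] 1, 0 ≤ r ∧ r < 1 := by
    filter_upwards [self_mem_nhdsWithin, mem_nhdsWithin_of_mem_nhds (Ioi_mem_nhds one_pos)]
      with r h1 h2
    exact ⟨le_of_lt h2, h1⟩
  -- The bound `C ^ 2` uses |φ| ≤ 1 and the maximum of |q| on the closed bidisk; the pointwise limit
  -- uses that |φ| has radial limit 1 almost everywhere.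
  refine tendsto_integral_filter_of_dominated_convergence (fun _ => C ^ 2) ?_ ?_
    (integrable_const _) ?_
  · filter_upwards [hev] with r hr
    exact ((continuous_torus_of_differentiableOn hd hr.1 hr.2).norm.pow 2).aestronglyMeasurable
  · filter_upwards [hev] with r hr
    refine .of_forall fun θ => ?_
    have hr1 : ∀ θ : ℝ, ‖(r : ℂ) * unitExp θ‖ < 1 := fun θ => by
      rw [norm_mul_unitExp hr.1]
      exact hr.2
    have h1 : ‖φ (r * unitExp θ.1, r * unitExp θ.2)‖ ≤ 1 :=
      hφ.norm_le_one (Complex.UnitDisc.mk _ (hr1 θ.1), Complex.UnitDisc.mk _ (hr1 θ.2))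
    have h2 : ‖q (r * unitExp θ.1, r * unitExp θ.2)‖ ≤ C := by
      refine hC _ ⟨?_, ?_⟩
      · simpa using (hr1 θ.1).le
      · simpa using (hr1 θ.2).le
    rw [norm_pow, norm_norm, Pi.mul_apply, norm_mul]
    refine pow_le_pow_left₀ (by positivity) ?_ 2
    exact (mul_le_of_le_one_left (norm_nonneg _) h1).trans h2
  · filter_upwards [torusMeasure_absolutelyContinuous.ae_le hφ.radial] with θ hθ
    have h1 : Continuous fun r : ℝ => ‖q (r * unitExp θ.1, r * unitExp θ.2)‖ :=
      (hq.continuous.comp (by fun_prop)).norm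
    have h2 := (hθ.mul ((h1.tendsto 1).mono_left nhdsWithin_le_nhds)).pow 2
    simpa [unitExp, norm_mul] using h2

/-- With this trivial inner function, `IsInner.exists_mul_entire` also expresses the norm of the
entire function itself as a torus integral, so the two norms can be compared. -/
theorem isInner_one : IsInner fun _ => 1 where
  differentiableOn := differentiableOn_const _
  norm_le_one _ := by simp
  radial := .of_forall fun _ => by simp

/-- The elements of the Hardy space that extend to entire functions. -/
def entireSubmodule : Submodule ℂ HardySpace where
  carrier := {Q | ∃ q : ℂ × ℂ → ℂ, Differentiable ℂ q ∧ ∀ z : Bidisk, Q z = q z.toProd}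
  add_mem' := by
    rintro _ _ ⟨p, hp, hp'⟩ ⟨q, hq, hq'⟩
    exact ⟨p + q, hp.add hq, fun z => by simp [hp', hq']⟩
  zero_mem' := ⟨0, differentiable_const _, fun z => by simp⟩
  smul_mem' := by
    rintro c _ ⟨q, hq, hq'⟩
    exact ⟨c • q, hq.const_smul c, fun z => by simp [hq']⟩

/-- The monomial `z₁ ^ p.1 * z₂ ^ p.2`. -/
def monomial (p : ℕ × ℕ) : HardySpace :=
  (lp.single 2 p (1 : ℂ) : lp (fun _ : ℕ × ℕ => ℂ) 2)

theorem coeff_monomial (p : ℕ × ℕ) : (monomial p).coeff = Pi.single p 1 := rfl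

theorem inner_monomial (p : ℕ × ℕ) (f : HardySpace) : inner ℂ (monomial p) f = f.coeff p := by
  refine (hasSum_inner _ _).unique ?_
  convert hasSum_single p ?_
  · simp [coeff_monomial]
  · intro q hq
    simp [coeff_monomial, hq]

theorem monomial_apply (p : ℕ × ℕ) (z : Bidisk) :
    monomial p z = (z.1 : ℂ) ^ p.1 * (z.2 : ℂ) ^ p.2 := by
  refine (hasSum_apply _ z).unique ?_
  have h := hasSum_single (f := fun q : ℕ × ℕ =>
    (monomial p).coeff q * ((z.1 : ℂ) ^ q.1 * (z.2 : ℂ) ^ q.2)) p fun q hq => by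
      simp [coeff_monomial, hq]
  simpa [coeff_monomial] using h

/-- An element orthogonal to all monomials has zero Taylor coefficients. -/
theorem dense_entireSubmodule : entireSubmodule.topologicalClosure = ⊤ := by
  rw [Submodule.topologicalClosure_eq_top_iff, Submodule.eq_bot_iff]
  intro f hf
  refine ext_coeff (funext fun p => ?_)
  rw [← inner_monomial]
  refine hf _ ⟨fun z => z.1 ^ p.1 * z.2 ^ p.2, by fun_prop, fun z => ?_⟩
  rw [monomial_apply]
  rfl

theorem IsInner.exists_mul_entireSubmodule {φ : ℂ × ℂ → ℂ} (hφ : IsInner φ)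
    (Q : entireSubmodule) : ∃ F : HardySpace, ‖F‖ = ‖Q‖ ∧
      ∀ z : Bidisk, F z = φ z.toProd * (Q : HardySpace) z := by
  obtain ⟨Q, q, hq, hQ⟩ := Q
  obtain ⟨F, hF, hFn⟩ := hφ.exists_mul_entire hq
  obtain ⟨G, hG, hGn⟩ := isInner_one.exists_mul_entire hq
  have hGQ : G = Q := RKHS.ext fun z => by rw [hG, hQ, one_mul]
  refine ⟨F, ?_, fun z => by rw [hF, hQ]⟩
  refine (pow_left_inj₀ (norm_nonneg _) (norm_nonneg _) two_ne_zero).1 ?_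
  rw [hFn, ← hGn, hGQ]
  rfl

/-- Multiplication by an inner function is an isometry of the Hardy space. -/
theorem IsInner.exists_mul {φ : ℂ × ℂ → ℂ} (hφ : IsInner φ) :
    ∃ M : HardySpace →ₗᵢ[ℂ] HardySpace, ∀ f (z : Bidisk), M f z = φ z.toProd * f z := by
  choose m hmn hm using hφ.exists_mul_entireSubmodule
  let m' : entireSubmodule →ₗ[ℂ] HardySpace :=
    { toFun := m
      map_add' := fun P Q => RKHS.ext fun z => by simp [hm, mul_add]
      map_smul' := fun c Q => RKHS.ext fun z => by simp [hm, mul_left_comm] }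
  have hdense : DenseRange entireSubmodule.subtype := by
    have h := entireSubmodule.dense_iff_topologicalClosure_eq_top.2 dense_entireSubmodule
    simpa [DenseRange] using h
  have hle : ∃ C, ∀ Q, ‖m' Q‖ ≤ C * ‖entireSubmodule.subtype Q‖ :=
    ⟨1, fun Q => by
      rw [one_mul]
      exact (hmn Q).le⟩
  have heq := LinearMap.extendOfNorm_eq hdense hle
  refine ⟨⟨(m'.extendOfNorm entireSubmodule.subtype : HardySpace →ₗ[ℂ] HardySpace), ?_⟩, ?_⟩
  · refine fun f => hdense.induction_on
      (p := fun f => ‖m'.extendOfNorm entireSubmodule.subtype f‖ = ‖f‖) f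
      (isClosed_eq (by fun_prop) (by fun_prop)) fun Q => ?_
    rw [heq]
    exact hmn Q
  -- The product formula passes to limits because point evaluations are continuous.
  · refine fun f z => hdense.induction_on
      (p := fun f => m'.extendOfNorm entireSubmodule.subtype f z = φ z.toProd * f z) f
      (isClosed_eq ?_ ?_) fun Q => ?_
    · exact (RKHS.continuous_eval z).comp (ContinuousLinearMap.continuous _)
    · exact continuous_const.mul (RKHS.continuous_eval z)
    · rw [heq]
      exact hm Q z

/-! ### The shifts and their adjoints -/

theorem inner_M₁_M₁ (f g : HardySpace) : inner ℂ (M₁ f) (M₁ g) = inner ℂ f g :=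
  (shift _ injective_succ1).inner_map_map f g

theorem inner_M₂_M₂ (f g : HardySpace) : inner ℂ (M₂ f) (M₂ g) = inner ℂ f g :=
  (shift _ injective_succ2).inner_map_map f g

theorem M₁_injective : Function.Injective M₁ := (shift _ injective_succ1).injective

theorem M₂_injective : Function.Injective M₂ := (shift _ injective_succ2).injective

theorem adjoint_M₁_M₁ (f : HardySpace) : M₁.adjoint (M₁ f) = f :=
  ext_inner_right ℂ fun g => by rw [ContinuousLinearMap.adjoint_inner_left, inner_M₁_M₁]

theorem adjoint_M₂_M₂ (f : HardySpace) : M₂.adjoint (M₂ f) = f :=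
  ext_inner_right ℂ fun g => by rw [ContinuousLinearMap.adjoint_inner_left, inner_M₂_M₂]

theorem M₁_M₂ (f : HardySpace) : M₁ (M₂ f) = M₂ (M₁ f) :=
  RKHS.ext fun z => by simp only [M₁_apply, M₂_apply, mul_left_comm]

theorem adjoint_M₁_szego (w : Bidisk) : M₁.adjoint (szego w) = conj (w.1 : ℂ) • szego w :=
  ext_inner_right ℂ fun f => by
    rw [ContinuousLinearMap.adjoint_inner_left, inner_smul_left, ← apply_eq_inner,
      ← apply_eq_inner, M₁_apply, Complex.conj_conj]

theorem adjoint_M₂_szego (w : Bidisk) : M₂.adjoint (szego w) = conj (w.2 : ℂ) • szego w :=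
  ext_inner_right ℂ fun f => by
    rw [ContinuousLinearMap.adjoint_inner_left, inner_smul_left, ← apply_eq_inner,
      ← apply_eq_inner, M₂_apply, Complex.conj_conj]

theorem M₁_monomial (m n : ℕ) : M₁ (monomial (m, n)) = monomial (m + 1, n) :=
  RKHS.ext fun z => by
    rw [M₁_apply, monomial_apply, monomial_apply]
    ring

theorem M₂_monomial (m n : ℕ) : M₂ (monomial (m, n)) = monomial (m, n + 1) :=
  RKHS.ext fun z => by
    rw [M₂_apply, monomial_apply, monomial_apply]
    ring

theorem coeff_adjoint_M₁ (f : HardySpace) (m n : ℕ) :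
    (M₁.adjoint f).coeff (m, n) = f.coeff (m + 1, n) := by
  rw [← inner_monomial, ContinuousLinearMap.adjoint_inner_right, M₁_monomial, inner_monomial]

theorem coeff_M₂_succ (f : HardySpace) (m n : ℕ) :
    (M₂ f).coeff (m, n + 1) = f.coeff (m, n) := by
  rw [← inner_monomial, ← M₂_monomial, inner_M₂_M₂, inner_monomial]

theorem coeff_M₂_zero (f : HardySpace) (m : ℕ) : (M₂ f).coeff (m, 0) = 0 :=
  Function.extend_apply' f.coeff (0 : ℕ × ℕ → ℂ) (m, 0) (by simp)

/-- The shifts doubly commute: each acts on its own exponent only. -/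
theorem adjoint_M₁_M₂ (f : HardySpace) : M₁.adjoint (M₂ f) = M₂ (M₁.adjoint f) := by
  refine ext_coeff (funext fun ⟨m, n⟩ => ?_)
  cases n with
  | zero => rw [coeff_adjoint_M₁, coeff_M₂_zero, coeff_M₂_zero]
  | succ n => rw [coeff_adjoint_M₁, coeff_M₂_succ, coeff_M₂_succ, coeff_adjoint_M₁]

theorem adjoint_M₂_M₁ (f : HardySpace) : M₂.adjoint (M₁ f) = M₁ (M₂.adjoint f) :=
  ext_inner_left ℂ fun g => by
    rw [ContinuousLinearMap.adjoint_inner_right, ← ContinuousLinearMap.adjoint_inner_left,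
      adjoint_M₁_M₂, ← ContinuousLinearMap.adjoint_inner_right,
      ContinuousLinearMap.adjoint_inner_left]

theorem szego_apply_mul (w z : Bidisk) :
    szego w z * ((1 - z.1 * conj (w.1 : ℂ)) * (1 - z.2 * conj (w.2 : ℂ))) = 1 := by
  have hlt : ∀ x y : 𝔻, ‖(x : ℂ) * conj (y : ℂ)‖ < 1 := fun x y => by
    rw [norm_mul, RCLike.norm_conj]
    exact mul_lt_one_of_nonneg_of_lt_one_left (norm_nonneg _) x.norm_lt_one y.norm_lt_one.le
  have h := (hasSum_geometric_of_norm_lt_one (hlt z.1 w.1)).mul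
    (hasSum_geometric_of_norm_lt_one (hlt z.2 w.2))
    (summable_mul_of_summable_norm (summable_norm_geometric_of_norm_lt_one (hlt z.1 w.1))
      (summable_norm_geometric_of_norm_lt_one (hlt z.2 w.2)))
  have h1 : szego w z = (1 - z.1 * conj (w.1 : ℂ))⁻¹ * (1 - z.2 * conj (w.2 : ℂ))⁻¹ := by
    refine (hasSum_apply (szego w) z).unique (h.congr_fun fun p => ?_)
    simp only [szego, coeff_mk, map_mul, map_pow, mul_pow]
    ring
  have h2 := one_sub_ne_zero_of_norm_lt_one (hlt z.1 w.1)
  have h3 := one_sub_ne_zero_of_norm_lt_one (hlt z.2 w.2)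
  rw [h1]
  field_simp

/-! ### Invariance properties of the model spaces -/

theorem M₁_mem_range {φ : ℂ × ℂ → ℂ} {f : HardySpace} (hf : f ∈ range φ) : M₁ f ∈ range φ := by
  obtain ⟨h, hh⟩ := hf
  exact ⟨M₁ h, fun z => by rw [M₁_apply, M₁_apply, hh, mul_left_comm]⟩

theorem M₂_mem_range {φ : ℂ × ℂ → ℂ} {f : HardySpace} (hf : f ∈ range φ) : M₂ f ∈ range φ := by
  obtain ⟨h, hh⟩ := hf
  exact ⟨M₂ h, fun z => by rw [M₂_apply, M₂_apply, hh, mul_left_comm]⟩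

theorem adjoint_M₁_mem_modelSpace {φ : ℂ × ℂ → ℂ} {f : HardySpace} (hf : f ∈ modelSpace φ) :
    M₁.adjoint f ∈ modelSpace φ := fun u hu => by
  rw [ContinuousLinearMap.adjoint_inner_right]
  exact hf _ (M₁_mem_range hu)

theorem adjoint_M₂_mem_modelSpace {φ : ℂ × ℂ → ℂ} {f : HardySpace} (hf : f ∈ modelSpace φ) :
    M₂.adjoint f ∈ modelSpace φ := fun u hu => by
  rw [ContinuousLinearMap.adjoint_inner_right]
  exact hf _ (M₂_mem_range hu)

theorem S₁max_le_modelSpace (φ : ℂ × ℂ → ℂ) : S₁max φ ≤ modelSpace φ :=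
  (isGreatest_S₁max φ).1.1

theorem M₁_mem_S₁max {φ : ℂ × ℂ → ℂ} {f : HardySpace} (hf : f ∈ S₁max φ) : M₁ f ∈ S₁max φ :=
  (isGreatest_S₁max φ).1.2 f hf

/-- Adjoining `f` to S₁^max keeps it invariant inside K_φ, so maximality absorbs `f`. -/
theorem mem_S₁max_of_M₁_mem {φ : ℂ × ℂ → ℂ} {f : HardySpace} (hf : f ∈ modelSpace φ)
    (h : M₁ f ∈ S₁max φ) : f ∈ S₁max φ := by
  have hle : S₁max φ ⊔ ℂ ∙ f ≤ S₁max φ := by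
    refine (isGreatest_S₁max φ).2 ⟨sup_le (S₁max_le_modelSpace φ) (by simpa using hf), ?_⟩
    intro g hg
    obtain ⟨s, hs, t, ht, rfl⟩ := Submodule.mem_sup.1 hg
    obtain ⟨c, rfl⟩ := Submodule.mem_span_singleton.1 ht
    refine Submodule.mem_sup_left ?_
    rw [map_add, map_smul]
    exact add_mem (M₁_mem_S₁max hs) (Submodule.smul_mem _ c h)
  exact hle (Submodule.mem_sup_right (Submodule.mem_span_singleton_self f))

/-- The image of S₁^max under M₂^* lies in K_φ and is invariant under M₁, since M₁ and M₂^* commute;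
maximality does the rest. -/
theorem adjoint_M₂_mem_S₁max {φ : ℂ × ℂ → ℂ} {f : HardySpace} (hf : f ∈ S₁max φ) :
    M₂.adjoint f ∈ S₁max φ := by
  have hle : (S₁max φ).map (M₂.adjoint : HardySpace →ₗ[ℂ] HardySpace) ≤ S₁max φ := by
    refine (isGreatest_S₁max φ).2 ⟨?_, ?_⟩
    · rintro _ ⟨g, hg, rfl⟩
      exact adjoint_M₂_mem_modelSpace (S₁max_le_modelSpace φ hg)
    · rintro _ ⟨g, hg, rfl⟩
      exact ⟨M₁ g, M₁_mem_S₁max hg, adjoint_M₂_M₁ g⟩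
  exact hle ⟨f, hf, rfl⟩

theorem isClosed_modelSpace (φ : ℂ × ℂ → ℂ) : IsClosed (modelSpace φ : Set HardySpace) :=
  Submodule.isClosed_orthogonal _

theorem isClosed_S₂min (φ : ℂ × ℂ → ℂ) : IsClosed (S₂min φ : Set HardySpace) :=
  (isClosed_modelSpace φ).inter (Submodule.isClosed_orthogonal _)

/-- If the elements of `K` orthogonal to a closed subspace `T ≤ K` lie in `S`, then those
orthogonal to `S` lie in `T`. -/
theorem inf_orthogonal_le_of_inf_orthogonal_le {E : Type*} [NormedAddCommGroup E]
    [InnerProductSpace ℂ E] {K S T : Submodule ℂ E} [T.HasOrthogonalProjection] (hT : T ≤ K)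
    (h : K ⊓ Tᗮ ≤ S) : K ⊓ Sᗮ ≤ T := by
  rintro f ⟨hfK, hfS⟩
  obtain ⟨t, ht, s, hs, rfl⟩ := T.exists_add_mem_mem_orthogonal f
  have hsK : s ∈ K := by
    have := K.sub_mem hfK (hT ht)
    rwa [add_sub_cancel_left] at this
  -- Since `s` lies in `S`, it is orthogonal to `t + s`; as it is also orthogonal to `t`, it
  -- vanishes.
  have h1 : inner ℂ s (t + s) = 0 := hfS s (h ⟨hsK, hs⟩)
  rw [inner_add_right, Submodule.inner_left_of_mem_orthogonal ht hs, zero_add,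
    inner_self_eq_zero] at h1
  rwa [h1, add_zero]

section Multiplication

variable {φ : ℂ × ℂ → ℂ} {M : HardySpace →ₗᵢ[ℂ] HardySpace}

theorem mem_modelSpace_iff (hM : ∀ f (z : Bidisk), M f z = φ z.toProd * f z) (f : HardySpace) :
    f ∈ modelSpace φ ↔ M.toContinuousLinearMap.adjoint f = 0 := by
  constructor
  · refine fun hf => ext_inner_left ℂ fun g => ?_
    rw [ContinuousLinearMap.adjoint_inner_right, inner_zero_right]
    exact hf _ ⟨g, hM g⟩
  · rintro hf u ⟨h, hh⟩
    have hu : u = M.toContinuousLinearMap h := RKHS.ext fun z => by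
      rw [hh]
      exact (hM h z).symm
    rw [hu, ← ContinuousLinearMap.adjoint_inner_right, hf, inner_zero_right]

theorem adjoint_self_apply (M : HardySpace →ₗᵢ[ℂ] HardySpace) (f : HardySpace) :
    M.toContinuousLinearMap.adjoint (M f) = f :=
  ext_inner_right ℂ fun g => by
    rw [ContinuousLinearMap.adjoint_inner_left]
    exact M.inner_map_map f g

theorem M₁_mul_comm (hM : ∀ f (z : Bidisk), M f z = φ z.toProd * f z) (f : HardySpace) :
    M₁ (M f) = M (M₁ f) :=
  RKHS.ext fun z => by rw [M₁_apply, hM, hM, M₁_apply, mul_left_comm]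

theorem M₂_mul_comm (hM : ∀ f (z : Bidisk), M f z = φ z.toProd * f z) (f : HardySpace) :
    M₂ (M f) = M (M₂ f) :=
  RKHS.ext fun z => by rw [M₂_apply, hM, hM, M₂_apply, mul_left_comm]

theorem adjoint_mul_szego (hM : ∀ f (z : Bidisk), M f z = φ z.toProd * f z) (w : Bidisk) :
    M.toContinuousLinearMap.adjoint (szego w) = conj (φ w.toProd) • szego w :=
  ext_inner_right ℂ fun f => by
    rw [ContinuousLinearMap.adjoint_inner_left, inner_smul_left, ← apply_eq_inner,
      ← apply_eq_inner, Complex.conj_conj]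
    exact hM f w

/-- M^* sends both terms to M₁^*h, because M^* commutes with M₁^* and M^*M = 1. -/
theorem adjoint_M₁_mul_sub_mem_modelSpace (hM : ∀ f (z : Bidisk), M f z = φ z.toProd * f z)
    (h : HardySpace) : M₁.adjoint (M h) - M (M₁.adjoint h) ∈ modelSpace φ := by
  rw [mem_modelSpace_iff hM, map_sub, adjoint_self_apply, sub_eq_zero]
  refine ext_inner_left ℂ fun g => ?_
  rw [ContinuousLinearMap.adjoint_inner_right, ContinuousLinearMap.adjoint_inner_right,
    ContinuousLinearMap.adjoint_inner_right]
  change inner ℂ (M₁ (M g)) (M h) = _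
  rw [M₁_mul_comm hM, M.inner_map_map]

/-- Let T consist of the t in K_φ with z₂t in K_φ. It is invariant under M₁^* and contains all
M₁^*Mh - MM₁^*h, which makes K_φ ⊖ T invariant under M₁. So K_φ ⊖ T lies in S₁^max, and taking
complements S₂^min lies in T. -/
theorem M₂_mem_modelSpace_of_mem_S₂min (hM : ∀ f (z : Bidisk), M f z = φ z.toProd * f z)
    {f : HardySpace} (hf : f ∈ S₂min φ) : M₂ f ∈ modelSpace φ := by
  set T : Submodule ℂ HardySpace :=
    modelSpace φ ⊓ (modelSpace φ).comap (M₂ : HardySpace →ₗ[ℂ] HardySpace) with hTdef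
  have hTc : IsClosed (T : Set HardySpace) :=
    (isClosed_modelSpace φ).inter ((isClosed_modelSpace φ).preimage M₂.continuous)
  have : CompleteSpace T := hTc.completeSpace_coe
  have hM₁T : ∀ t ∈ T, M₁.adjoint t ∈ T := fun t ht => by
    refine ⟨adjoint_M₁_mem_modelSpace ht.1, ?_⟩
    change M₂ (M₁.adjoint t) ∈ modelSpace φ
    rw [← adjoint_M₁_M₂]
    exact adjoint_M₁_mem_modelSpace ht.2
  have hcomm : ∀ h, M₁.adjoint (M h) - M (M₁.adjoint h) ∈ T := fun h => by
    refine ⟨adjoint_M₁_mul_sub_mem_modelSpace hM h, ?_⟩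
    change M₂ (_ - _) ∈ modelSpace φ
    -- M₂ carries the commutator at `h` to the commutator at M₂h.
    rw [map_sub, ← adjoint_M₁_M₂, M₂_mul_comm hM, M₂_mul_comm hM, ← adjoint_M₁_M₂]
    exact adjoint_M₁_mul_sub_mem_modelSpace hM _
  have hle : modelSpace φ ⊓ Tᗮ ≤ S₁max φ := by
    refine (isGreatest_S₁max φ).2 ⟨inf_le_left, fun g hg => ⟨?_, fun t ht => ?_⟩⟩
    -- ⟨Mh, M₁g⟩ = ⟨M₁^*Mh, g⟩, and M₁^*Mh is an element of T plus an element of φH², both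
    -- orthogonal to `g`.
    · refine (mem_modelSpace_iff hM _).2 (ext_inner_left ℂ fun h => ?_)
      rw [ContinuousLinearMap.adjoint_inner_right, inner_zero_right,
        ← ContinuousLinearMap.adjoint_inner_left]
      have h1 : inner ℂ (M₁.adjoint (M h) - M (M₁.adjoint h)) g = 0 := hg.2 _ (hcomm h)
      have h2 : inner ℂ (M (M₁.adjoint h)) g = 0 := hg.1 _ ⟨_, hM _⟩
      rwa [inner_sub_left, h2, sub_zero] at h1
    · rw [← ContinuousLinearMap.adjoint_inner_left]
      exact hg.2 _ (hM₁T t ht)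
  exact (inf_orthogonal_le_of_inf_orthogonal_le inf_le_left hle hf).2

theorem M₂_mem_S₂min (hM : ∀ f (z : Bidisk), M f z = φ z.toProd * f z)
    {f : HardySpace} (hf : f ∈ S₂min φ) : M₂ f ∈ S₂min φ := by
  refine ⟨M₂_mem_modelSpace_of_mem_S₂min hM hf, fun g hg => ?_⟩
  rw [← ContinuousLinearMap.adjoint_inner_left]
  exact hf.2 _ (adjoint_M₂_mem_S₁max hg)

/-- This and its companion for `K₂min` place the cross terms of `projections_of_eq` in z₂S₂^min and
z₁S₁^max, where the projections kill them. -/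
theorem adjoint_M₁_mem_S₂min_of_mem_K₁max {f : HardySpace} (hf : f ∈ K₁max φ) :
    M₁.adjoint f ∈ S₂min φ := by
  refine ⟨adjoint_M₁_mem_modelSpace (S₁max_le_modelSpace φ hf.1), fun g hg => ?_⟩
  rw [ContinuousLinearMap.adjoint_inner_right]
  exact hf.2 _ ⟨g, hg, rfl⟩

theorem adjoint_M₂_mem_S₁max_of_mem_K₂min {f : HardySpace} (hf : f ∈ K₂min φ) :
    M₂.adjoint f ∈ S₁max φ := by
  have : CompleteSpace (S₁max φ) := (isClosed_S₁max φ).completeSpace_coe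
  have : CompleteSpace (S₂min φ) := (isClosed_S₂min φ).completeSpace_coe
  refine inf_orthogonal_le_of_inf_orthogonal_le (S₁max_le_modelSpace φ) le_rfl
    ⟨adjoint_M₂_mem_modelSpace hf.1.1, fun g hg => ?_⟩
  rw [ContinuousLinearMap.adjoint_inner_right]
  exact hf.2 _ ⟨g, hg, rfl⟩

/-! ### The reproducing kernels -/

theorem inner_k₁max (w : Bidisk) (f : K₁max φ) :
    inner ℂ (k₁max φ w) f = (f : HardySpace) w := by
  rw [k₁max, RKHS.kerFun_inner]
  simp [coe_submodule_apply]

theorem inner_k₂min (w : Bidisk) (f : K₂min φ) :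
    inner ℂ (k₂min φ w) f = (f : HardySpace) w := by
  rw [k₂min, RKHS.kerFun_inner]
  simp [coe_submodule_apply]

/-- The projection of an eigenvector of `A^*` to the wandering subspace of an isometry `A` on an
invariant subspace. -/
theorem sub_smul_map_mem_wandering {E : Type*} [NormedAddCommGroup E] [InnerProductSpace ℂ E]
    [CompleteSpace E] {S : Submodule ℂ E} {A : E →L[ℂ] E}
    (hA : ∀ x y, inner ℂ (A x) (A y) = inner ℂ x y) (hAS : ∀ x ∈ S, A x ∈ S) {s u : E} {c : ℂ}
    (hs : A.adjoint s = c • s) (hu : u ∈ S) (hsu : s - u ∈ Sᗮ) :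
    u - c • A u ∈ S ⊓ (S.map (A : E →ₗ[ℂ] E))ᗮ ∧
      ∀ x ∈ S ⊓ (S.map (A : E →ₗ[ℂ] E))ᗮ, inner ℂ (u - c • A u) x = inner ℂ s x := by
  have hin : ∀ x ∈ S, inner ℂ x u = inner ℂ x s := fun x hx => by
    have h := hsu x hx
    rw [inner_sub_right, sub_eq_zero] at h
    exact h.symm
  refine ⟨⟨S.sub_mem hu (S.smul_mem c (hAS u hu)), ?_⟩, fun x hx => ?_⟩
  · rintro _ ⟨g, hg, rfl⟩
    change inner ℂ (A g) _ = 0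
    -- In pairings with `S`, `u` may be replaced by `s`; then A^*s = cs and the isometry property
    -- cancel the two terms.
    rw [inner_sub_right, inner_smul_right, hA, hin _ (hAS g hg), hin g hg,
      ← ContinuousLinearMap.adjoint_inner_right, hs, inner_smul_right, sub_self]
  · have h1 : inner ℂ (A u) x = 0 := hx.2 _ ⟨u, hu, rfl⟩
    rw [inner_sub_left, inner_smul_left, h1, mul_zero, sub_zero, ← inner_conj_symm, hin x hx.1,
      inner_conj_symm]

/-- u₁ and u₂ are the projections of s_w to S₁^max and S₂^min, so their sum is its projection to
K_φ. As s_w is an eigenvector of both backward shifts, `sub_smul_map_mem_wandering` turns each uⱼ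
into the kernel of the wandering subspace. -/
theorem exists_decomposition_szego (hM : ∀ f (z : Bidisk), M f z = φ z.toProd * f z)
    (w : Bidisk) : ∃ u₁ u₂ : HardySpace,
      u₁ + u₂ = szego w - conj (φ w.toProd) • M (szego w) ∧
      (k₁max φ w : HardySpace) = u₁ - conj (w.1 : ℂ) • M₁ u₁ ∧
      (k₂min φ w : HardySpace) = u₂ - conj (w.2 : ℂ) • M₂ u₂ := by
  have : CompleteSpace (S₁max φ) := (isClosed_S₁max φ).completeSpace_coe
  have : CompleteSpace (S₂min φ) := (isClosed_S₂min φ).completeSpace_coe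
  obtain ⟨u₁, hu₁, v₁, hv₁, h₁⟩ := (S₁max φ).exists_add_mem_mem_orthogonal (szego w)
  obtain ⟨u₂, hu₂, v₂, hv₂, h₂⟩ := (S₂min φ).exists_add_mem_mem_orthogonal (szego w)
  have hv₁' : szego w - u₁ ∈ (S₁max φ)ᗮ := by rwa [h₁, add_sub_cancel_left]
  have hv₂' : szego w - u₂ ∈ (S₂min φ)ᗮ := by rwa [h₂, add_sub_cancel_left]
  refine ⟨u₁, u₂, ?_, ?_, ?_⟩
  · have hK : szego w - conj (φ w.toProd) • M (szego w) ∈ modelSpace φ := by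
      rw [mem_modelSpace_iff hM, map_sub, map_smul, adjoint_self_apply, adjoint_mul_szego hM,
        sub_self]
    have hMK : ∀ x ∈ modelSpace φ, inner ℂ x (M (szego w)) = 0 := fun x hx => by
      rw [← inner_conj_symm, show inner ℂ (M (szego w)) x = 0 from hx _ ⟨_, hM _⟩, map_zero]
    set d := szego w - conj (φ w.toProd) • M (szego w) - u₁ - u₂ with hd
    have hdS : d ∈ S₂min φ := by
      refine ⟨sub_mem (sub_mem hK (S₁max_le_modelSpace φ hu₁)) hu₂.1, fun x hx => ?_⟩
      have h3 : inner ℂ x (szego w - u₁) = 0 := hv₁' x hx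
      have h4 : inner ℂ x u₂ = 0 := hu₂.2 x hx
      rw [hd, show szego w - conj (φ w.toProd) • M (szego w) - u₁ - u₂ =
        (szego w - u₁) - conj (φ w.toProd) • M (szego w) - u₂ by abel, inner_sub_right,
        inner_sub_right, inner_smul_right, h3, h4, hMK x (S₁max_le_modelSpace φ hx)]
      simp
    have hd0 : inner ℂ d d = 0 := by
      have h3 : inner ℂ d (szego w - u₂) = 0 := hv₂' d hdS
      have h4 : inner ℂ d u₁ = 0 := Submodule.inner_left_of_mem_orthogonal hu₁ hdS.2
      nth_rewrite 2 [hd]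
      rw [show szego w - conj (φ w.toProd) • M (szego w) - u₁ - u₂ =
        (szego w - u₂) - conj (φ w.toProd) • M (szego w) - u₁ by abel, inner_sub_right,
        inner_sub_right, inner_smul_right, h3, h4, hMK d hdS.1]
      simp
    rw [inner_self_eq_zero, hd, sub_sub, sub_eq_zero] at hd0
    exact hd0.symm
  · obtain ⟨hm, hi⟩ := sub_smul_map_mem_wandering inner_M₁_M₁ (fun _ => M₁_mem_S₁max)
      (adjoint_M₁_szego w) hu₁ hv₁'
    have h : k₁max φ w = ⟨_, hm⟩ := ext_inner_right ℂ fun x => by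
      rw [inner_k₁max, apply_eq_inner]
      exact (hi x x.2).symm
    rw [h]
  · obtain ⟨hm, hi⟩ := sub_smul_map_mem_wandering inner_M₂_M₂ (fun _ => M₂_mem_S₂min hM)
      (adjoint_M₂_szego w) hu₂ hv₂'
    have h : k₂min φ w = ⟨_, hm⟩ := ext_inner_right ℂ fun x => by
      rw [inner_k₂min, apply_eq_inner]
      exact (hi x x.2).symm
    rw [h]

/-- The Agler decomposition of an inner function by the canonical kernels. -/
theorem agler_decomposition (hM : ∀ f (z : Bidisk), M f z = φ z.toProd * f z) (z w : Bidisk) :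
    1 - φ z.toProd * conj (φ w.toProd) =
      (1 - z.2 * conj (w.2 : ℂ)) * (k₁max φ w : HardySpace) z +
        (1 - z.1 * conj (w.1 : ℂ)) * (k₂min φ w : HardySpace) z := by
  obtain ⟨u₁, u₂, hu, h₁, h₂⟩ := exists_decomposition_szego hM w
  have h3 : u₁ z + u₂ z = szego w z - conj (φ w.toProd) * (φ z.toProd * szego w z) := by
    have h := congrArg (fun f : HardySpace => f z) hu
    simpa [hM] using h
  have h4 := szego_apply_mul w z
  rw [h₁, h₂]
  simp only [RKHS.coe_sub, RKHS.coe_smul, Pi.sub_apply, Pi.smul_apply, smul_eq_mul, M₁_apply,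
    M₂_apply]
  -- Each kernel is its uⱼ(z) times 1 - zⱼ conj wⱼ, so both summands carry the full reciprocal of
  -- the Szegő kernel as a factor.
  linear_combination (-(1 - φ z.toProd * conj (φ w.toProd))) * h4 -
    ((1 - z.1 * conj (w.1 : ℂ)) * (1 - z.2 * conj (w.2 : ℂ))) * h3

end Multiplication

/-! ### The lurking isometry -/

section LurkingIsometry

variable {E ι : Type*} [NormedAddCommGroup E] [InnerProductSpace ℂ E]

/-- Two families with the same Gram matrix, the first of them total, are related by an
isometry. -/
theorem exists_linearIsometry_of_inner_eq [CompleteSpace E] {G R : ι → E}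
    (h : ∀ i j, inner ℂ (G i) (G j) = inner ℂ (R i) (R j))
    (hG : (Submodule.span ℂ (Set.range G)).topologicalClosure = ⊤) :
    ∃ V : E →ₗᵢ[ℂ] E, ∀ i, V (G i) = R i := by
  set e := Finsupp.linearCombination ℂ G
  set f := Finsupp.linearCombination ℂ R
  have hdense : DenseRange e := by
    rw [DenseRange, ← LinearMap.coe_range, Finsupp.range_linearCombination,
      Submodule.dense_iff_topologicalClosure_eq_top]
    exact hG
  have hnorm : ∀ x, ‖f x‖ = ‖e x‖ := fun x => by
    have hi : inner ℂ (f x) (f x) = inner ℂ (e x) (e x) := by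
      simp only [e, f, Finsupp.linearCombination_apply, Finsupp.sum_inner, Finsupp.inner_sum,
        inner_smul_left, inner_smul_right, h]
    rw [@norm_eq_sqrt_re_inner ℂ, @norm_eq_sqrt_re_inner ℂ, hi]
  have heq := LinearMap.extendOfNorm_eq hdense ⟨1, fun x => by rw [one_mul, hnorm]⟩
  refine ⟨⟨(f.extendOfNorm e : E →ₗ[ℂ] E), ?_⟩, fun i => ?_⟩
  · refine fun y => hdense.induction_on (p := fun y => ‖f.extendOfNorm e y‖ = ‖y‖) y
      (isClosed_eq (by fun_prop) (by fun_prop)) fun x => ?_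
    rw [heq, hnorm]
  · have hi := heq (Finsupp.single i 1)
    simp only [e, f, Finsupp.linearCombination_single, one_smul] at hi
    exact hi

theorem linearIsometry_ext_of_span {G : ι → E}
    (hG : (Submodule.span ℂ (Set.range G)).topologicalClosure = ⊤) {V W : E →ₗᵢ[ℂ] E}
    (h : ∀ i, V (G i) = W (G i)) : V = W := by
  have h1 : V.toContinuousLinearMap = W.toContinuousLinearMap := by
    refine ContinuousLinearMap.ext_on (s := Set.range G)
      (Submodule.dense_iff_topologicalClosure_eq_top.2 hG) ?_
    rintro _ ⟨i, rfl⟩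
    exact h i
  ext x
  exact DFunLike.congr_fun h1 x

end LurkingIsometry

variable {φ : ℂ × ℂ → ℂ}

/-- The argument of the lurking isometry in its defining equation. -/
def sourceColumn (φ : ℂ × ℂ → ℂ) (w : Bidisk) : ColumnSpace φ :=
  ColumnSpace.col 1 (H.col (conj (w.1 : ℂ) • k₂min φ w) (conj (w.2 : ℂ) • k₁max φ w))

/-- The value of the lurking isometry in its defining equation. -/
def targetColumn (φ : ℂ × ℂ → ℂ) (w : Bidisk) : ColumnSpace φ :=
  ColumnSpace.col (conj (φ w.toProd)) (H.col (k₂min φ w) (k₁max φ w))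

theorem inner_sourceColumn (w : Bidisk) (x : ℂ) (f₁ : K₂min φ) (f₂ : K₁max φ) :
    inner ℂ (sourceColumn φ w) (ColumnSpace.col x (H.col f₁ f₂)) =
      x + (w.1 * (f₁ : HardySpace) w + w.2 * (f₂ : HardySpace) w) := by
  simp only [sourceColumn, ColumnSpace.col, H.col, WithLp.prod_inner_apply, inner_smul_left,
    inner_k₁max, inner_k₂min, Complex.conj_conj]
  simp

theorem inner_targetColumn (w : Bidisk) (x : ℂ) (f₁ : K₂min φ) (f₂ : K₁max φ) :
    inner ℂ (targetColumn φ w) (ColumnSpace.col x (H.col f₁ f₂)) =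
      φ w.toProd * x + ((f₁ : HardySpace) w + (f₂ : HardySpace) w) := by
  simp only [targetColumn, ColumnSpace.col, H.col, WithLp.prod_inner_apply,
    inner_k₁max, inner_k₂min]
  simp [mul_comm]

/-- The relation forces f₁ = z₂g and f₂ = -z₁g. Then g = M₂^*f₁ is in K_φ and z₁g is in S₁^max, so g
is in S₁^max by maximality; thus f₂ lies in z₁S₁^max and is orthogonal to it. -/
theorem eq_zero_of_M₁_add_M₂_eq_zero {f₁ f₂ : HardySpace} (h₁ : f₁ ∈ K₂min φ)
    (h₂ : f₂ ∈ K₁max φ) (h : M₁ f₁ + M₂ f₂ = 0) : f₁ = 0 ∧ f₂ = 0 := by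
  have hf₂ : f₂ = 0 := by
    set g := -M₁.adjoint f₂ with hg
    have hf₁ : f₁ = M₂ g := by
      have h3 := congrArg M₁.adjoint h
      rw [map_add, adjoint_M₁_M₁, adjoint_M₁_M₂, map_zero] at h3
      rw [hg, map_neg]
      exact eq_neg_of_add_eq_zero_left h3
    have hf₂ : f₂ = -M₁ g := by
      rw [hf₁, M₁_M₂, ← map_add] at h
      exact eq_neg_of_add_eq_zero_right (M₂_injective (h.trans (map_zero M₂).symm))
    have hgK : g ∈ modelSpace φ := by
      have h3 := adjoint_M₂_mem_modelSpace h₁.1.1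
      rwa [hf₁, adjoint_M₂_M₂] at h3
    have hgS : g ∈ S₁max φ := by
      refine mem_S₁max_of_M₁_mem hgK ?_
      have h3 := neg_mem h₂.1
      rwa [hf₂, neg_neg] at h3
    have h4 : inner ℂ (M₁ g) f₂ = 0 := h₂.2 _ ⟨g, hgS, rfl⟩
    rw [hf₂, inner_neg_right, neg_eq_zero, inner_self_eq_zero] at h4
    rw [hf₂, h4, neg_zero]
  refine ⟨?_, hf₂⟩
  rw [hf₂, map_zero, add_zero] at h
  exact M₁_injective (h.trans (map_zero M₁).symm)

theorem dense_sourceColumn (φ : ℂ × ℂ → ℂ) :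
    (Submodule.span ℂ (Set.range (sourceColumn φ))).topologicalClosure = ⊤ := by
  rw [Submodule.topologicalClosure_eq_top_iff, Submodule.eq_bot_iff]
  rintro ⟨x, ⟨f₁, f₂⟩⟩ hf
  have h : ∀ w : Bidisk, x + (w.1 * (f₁ : HardySpace) w + w.2 * (f₂ : HardySpace) w) = 0 :=
    fun w => by
      rw [← inner_sourceColumn]
      exact hf _ (Submodule.subset_span ⟨w, rfl⟩)
  have hx : x = 0 := by simpa using h 0
  subst hx
  obtain ⟨h₁, h₂⟩ := eq_zero_of_M₁_add_M₂_eq_zero f₁.2 f₂.2 (RKHS.ext fun w => by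
    simpa [M₁_apply, M₂_apply] using h w)
  have h₁' : f₁ = 0 := Subtype.ext h₁
  have h₂' : f₂ = 0 := Subtype.ext h₂
  subst h₁' h₂'
  rfl

theorem existsUnique_lurkingIsometry (hφ : IsInner φ) :
    ∃! V : ColumnSpace φ →ₗᵢ[ℂ] ColumnSpace φ, IsLurkingIsometry φ V := by
  obtain ⟨M, hM⟩ := hφ.exists_mul
  have hGram : ∀ z w, inner ℂ (sourceColumn φ z) (sourceColumn φ w) =
      inner ℂ (targetColumn φ z) (targetColumn φ w) := fun z w => by
    have h := agler_decomposition hM z w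
    rw [targetColumn.eq_1 φ w, inner_targetColumn, sourceColumn.eq_1 φ w, inner_sourceColumn]
    simp only [Submodule.coe_smul, RKHS.coe_smul, Pi.smul_apply, smul_eq_mul]
    linear_combination h
  obtain ⟨V, hV⟩ := exists_linearIsometry_of_inner_eq hGram (dense_sourceColumn φ)
  exact ⟨V, hV, fun W hW => linearIsometry_ext_of_span (dense_sourceColumn φ)
    fun w => (hW w).trans (hV w).symm⟩

/-! ### The blocks of the adjoint -/

section Blocks

variable {V : ColumnSpace φ →ₗᵢ[ℂ] ColumnSpace φ}

theorem adj_eq_col (V : ColumnSpace φ →ₗᵢ[ℂ] ColumnSpace φ) (x : ℂ) (f : H φ) :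
    adj V (ColumnSpace.col x f) =
      ColumnSpace.col (blockA (adj V) x + blockB (adj V) f)
        (blockC (adj V) x + blockD (adj V) f) := by
  have h : ColumnSpace.col x f = inl ℂ (H φ) x + inr ℂ (H φ) f := by
    refine (WithLp.ofLp_injective 2) (Prod.ext ?_ ?_)
    · simp [ColumnSpace.col, inl, inr]
    · simp [ColumnSpace.col, inl, inr]
  rw [h, map_add]
  rfl

/-- The defining equation of the lurking isometry in terms of its adjoint. -/
theorem IsLurkingIsometry.adj_apply (hV : IsLurkingIsometry φ V) {x y : ℂ} {f₁ g₁ : K₂min φ}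
    {f₂ g₂ : K₁max φ}
    (h : adj V (ColumnSpace.col x (H.col f₁ f₂)) = ColumnSpace.col y (H.col g₁ g₂))
    (w : Bidisk) :
    y + (w.1 * (g₁ : HardySpace) w + w.2 * (g₂ : HardySpace) w) =
      φ w.toProd * x + ((f₁ : HardySpace) w + (f₂ : HardySpace) w) := by
  rw [← inner_sourceColumn, ← inner_targetColumn, ← h, adj,
    ContinuousLinearMap.adjoint_inner_right]
  exact congrArg (fun u => inner ℂ u _) (hV w)

theorem P₁_eq_of_mem {g : K₁max φ} {f : HardySpace} (h : f - g ∈ (K₁max φ)ᗮ) : P₁ φ f = g := by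
  have h1 : f = g + (f - g) := by abel
  rw [h1, P₁, map_add, Submodule.orthogonalProjectionOnto_mem_subspace_eq_self,
    Submodule.orthogonalProjectionOnto_eq_zero_iff.2 h, add_zero]

theorem P₂_eq_of_mem {g : K₂min φ} {f : HardySpace} (h : f - g ∈ (K₂min φ)ᗮ) : P₂ φ f = g := by
  have h1 : f = g + (f - g) := by abel
  rw [h1, P₂, map_add, Submodule.orthogonalProjectionOnto_mem_subspace_eq_self,
    Submodule.orthogonalProjectionOnto_eq_zero_iff.2 h, add_zero]

/-- M₁^*h = g₁ + z₂M₁^*g₂, and the second term lies in z₂S₂^min, orthogonal to H(K₂^min);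
symmetrically for M₂^*. Here `c` stands for the constant term, killed by both backward shifts. -/
theorem projections_of_eq {c h : HardySpace} {g₁ : K₂min φ} {g₂ : K₁max φ}
    (hc₁ : M₁.adjoint c = 0) (hc₂ : M₂.adjoint c = 0) (heq : c + (M₁ g₁ + M₂ g₂) = h) :
    P₂ φ (M₁.adjoint h) = g₁ ∧ P₁ φ (M₂.adjoint h) = g₂ := by
  subst heq
  constructor
  · refine P₂_eq_of_mem ?_
    rw [map_add, map_add, hc₁, adjoint_M₁_M₁, adjoint_M₁_M₂, zero_add, add_sub_cancel_left]
    refine fun k hk => ?_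
    rw [← inner_conj_symm, show inner ℂ (M₂ (M₁.adjoint (g₂ : HardySpace))) k = 0 from
      hk.2 _ ⟨_, adjoint_M₁_mem_S₂min_of_mem_K₁max g₂.2, rfl⟩, map_zero]
  · refine P₁_eq_of_mem ?_
    rw [map_add, map_add, hc₂, adjoint_M₂_M₂, adjoint_M₂_M₁, zero_add, add_sub_cancel_right]
    refine fun k hk => ?_
    rw [← inner_conj_symm, show inner ℂ (M₁ (M₂.adjoint (g₁ : HardySpace))) k = 0 from
      hk.2 _ ⟨_, adjoint_M₂_mem_S₁max_of_mem_K₂min g₁.2, rfl⟩, map_zero]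

theorem adjoint_M₁_monomial_zero : M₁.adjoint (monomial (0, 0)) = 0 :=
  ext_coeff (funext fun ⟨m, n⟩ => by
    rw [coeff_adjoint_M₁, coeff_monomial, Pi.single_eq_of_ne (by simp)]
    rfl)

theorem adjoint_M₂_monomial_zero : M₂.adjoint (monomial (0, 0)) = 0 :=
  ext_inner_right ℂ fun f => by
    rw [ContinuousLinearMap.adjoint_inner_left, inner_monomial, coeff_M₂_zero, inner_zero_left]

/-- The adjoint of the lurking isometry, in terms of the backward shifts. -/
theorem IsLurkingIsometry.adj_col (hV : IsLurkingIsometry φ V) {Φ : HardySpace}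
    (hΦ : ∀ z : Bidisk, Φ z = φ z.toProd) (x : ℂ) (f₁ : K₂min φ) (f₂ : K₁max φ) :
    adj V (ColumnSpace.col x (H.col f₁ f₂)) =
      ColumnSpace.col (φ (0, 0) * x + ((f₁ : HardySpace) + (f₂ : HardySpace)) (0 : Bidisk))
        (H.col (P₂ φ (M₁.adjoint (x • Φ + (f₁ + f₂)))) (P₁ φ (M₂.adjoint (x • Φ + (f₁ + f₂))))) := by
  obtain ⟨y, g₁, g₂, hy⟩ : ∃ (y : ℂ) (g₁ : K₂min φ) (g₂ : K₁max φ),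
      adj V (ColumnSpace.col x (H.col f₁ f₂)) = ColumnSpace.col y (H.col g₁ g₂) :=
    ⟨_, _, _, rfl⟩
  have h := hV.adj_apply hy
  obtain ⟨h₁, h₂⟩ := projections_of_eq (c := y • monomial (0, 0)) (g₁ := g₁) (g₂ := g₂)
    (h := x • Φ + (f₁ + f₂)) (by rw [map_smul, adjoint_M₁_monomial_zero, smul_zero])
    (by rw [map_smul, adjoint_M₂_monomial_zero, smul_zero]) (RKHS.ext fun w => by
      simpa [M₁_apply, M₂_apply, monomial_apply, hΦ, mul_comm x] using h w)
  -- At the origin the terms with z₁ and z₂ vanish, leaving the scalar entry `y`.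
  have h0 := h 0
  rw [hy, h₁, h₂]
  congr 1
  simpa [Bidisk.toProd] using h0

/-! ### Invertibility of 1 - E_z D and the realization formula -/

theorem norm_Ez_lt_one (z : Bidisk) : ‖Ez φ z‖ < 1 := by
  set r := max ‖(z.1 : ℂ)‖ ‖(z.2 : ℂ)‖
  have hr : r < 1 := max_lt z.1.norm_lt_one z.2.norm_lt_one
  refine (ContinuousLinearMap.opNorm_le_bound _ (le_max_of_le_left (norm_nonneg _))
    fun f => ?_).trans_lt hr
  have h : Ez φ z f = WithLp.toLp 2 ((z.1 : ℂ) • f.fst, (z.2 : ℂ) • f.snd) := by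
    refine (WithLp.ofLp_injective 2) (Prod.ext ?_ ?_)
    · simp [Ez, inl, inr]
    · simp [Ez, inl, inr]
  have h0 : 0 ≤ r := le_max_of_le_left (norm_nonneg _)
  refine (pow_le_pow_iff_left₀ (norm_nonneg _) (by positivity) two_ne_zero).1 ?_
  rw [h, mul_pow, WithLp.prod_norm_sq_eq_of_L2, WithLp.prod_norm_sq_eq_of_L2, mul_add]
  refine add_le_add ?_ ?_
  · rw [WithLp.toLp_fst, norm_smul, mul_pow]
    gcongr
    exact le_max_left _ _
  · rw [WithLp.toLp_snd, norm_smul, mul_pow]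
    gcongr
    exact le_max_right _ _

theorem norm_blockD_adj_le (V : ColumnSpace φ →ₗᵢ[ℂ] ColumnSpace φ) : ‖blockD (adj V)‖ ≤ 1 := by
  refine ContinuousLinearMap.opNorm_le_bound _ zero_le_one fun f => ?_
  have h1 : ‖adj V‖ ≤ 1 := by
    rw [adj, LinearIsometryEquiv.norm_map]
    exact V.norm_toContinuousLinearMap_le
  have h2 : ‖blockD (adj V) f‖ ≤ ‖adj V (inr ℂ (H φ) f)‖ := WithLp.norm_snd_le _ _
  have h3 : ‖inr ℂ (H φ) f‖ = ‖f‖ := WithLp.norm_toLp_snd 2 _ _ f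
  rw [one_mul, ← h3]
  exact h2.trans ((adj V).le_of_opNorm_le h1 _ |>.trans_eq (one_mul _))

theorem isUnit_one_sub_Ez_mul_blockD (V : ColumnSpace φ →ₗᵢ[ℂ] ColumnSpace φ) (z : Bidisk) :
    IsUnit (1 - Ez φ z * blockD (adj V)) := by
  refine isUnit_one_sub_of_norm_lt_one (R := H φ →L[ℂ] H φ) ?_
  refine (ContinuousLinearMap.opNorm_comp_le _ _).trans_lt ?_
  exact (mul_le_of_le_one_right (norm_nonneg _) (norm_blockD_adj_le V)).trans_lt
    (norm_Ez_lt_one z)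

theorem IsLurkingIsometry.realization (hV : IsLurkingIsometry φ V) (z : Bidisk) :
    φ z.toProd = blockA (adj V) 1 + blockB (adj V)
      (Ring.inverse (1 - Ez φ z * blockD (adj V)) (Ez φ z (blockC (adj V) 1))) := by
  set f := Ring.inverse (1 - Ez φ z * blockD (adj V)) (Ez φ z (blockC (adj V) 1)) with hf
  have h1 : (1 - Ez φ z * blockD (adj V)) f = Ez φ z (blockC (adj V) 1) := by
    rw [hf, ← mul_apply_eq_comp,
      Ring.mul_inverse_cancel _ (isUnit_one_sub_Ez_mul_blockD V z)]
    rfl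
  -- With this `g`, V^*(1, f) = (A + Bf, g) and f = E_z g; evaluated at the same point z, the
  -- functions on the two sides of `adj_apply` cancel.
  set g := blockC (adj V) 1 + blockD (adj V) f with hg
  have h2 : f = Ez φ z g := by
    rw [hg, map_add, ← h1]
    simp
  have h3 := hV.adj_apply (f₁ := f.fst) (f₂ := f.snd) (g₁ := g.fst) (g₂ := g.snd)
    (adj_eq_col V 1 f) z
  have h4 : f.fst = (z.1 : ℂ) • g.fst := by
    rw [h2]
    simp [Ez, inl, inr]
  have h5 : f.snd = (z.2 : ℂ) • g.snd := by
    rw [h2]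
    simp [Ez, inl, inr]
  rw [h4, h5] at h3
  simp only [Submodule.coe_smul, RKHS.coe_smul, Pi.smul_apply, smul_eq_mul, mul_one] at h3
  exact (add_right_cancel h3).symm

end Blocks

end BidiskInner

end

theorem theorem2p1 (φ : ℂ × ℂ → ℂ) (hφ : IsInner φ) :
    (∃ Φ : HardySpace, ∀ z : Bidisk, Φ z = φ z.toProd) ∧
    (∃! V : ColumnSpace φ →ₗᵢ[ℂ] ColumnSpace φ, IsLurkingIsometry φ V) ∧
    ∀ (Φ : HardySpace) (V : ColumnSpace φ →ₗᵢ[ℂ] ColumnSpace φ),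
      (∀ z : Bidisk, Φ z = φ z.toProd) → IsLurkingIsometry φ V →
      -- the concrete realization
      (∀ z : Bidisk, IsUnit (1 - Ez φ z * blockD (adj V)) ∧
        φ z.toProd = blockA (adj V) 1 +
          blockB (adj V) (Ring.inverse (1 - Ez φ z * blockD (adj V))
            (Ez φ z (blockC (adj V) 1)))) ∧
      -- the formulas for the blocks
      (∀ x : ℂ, blockA (adj V) x = φ (0, 0) * x) ∧
      (∀ (f₁ : K₂min φ) (f₂ : K₁max φ),
        blockB (adj V) (H.col f₁ f₂) = ((f₁ : HardySpace) + (f₂ : HardySpace)) (0 : Bidisk)) ∧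
      (∀ x : ℂ, blockC (adj V) x = x • H.col (P₂ φ (M₁.adjoint Φ)) (P₁ φ (M₂.adjoint Φ))) ∧
      (∀ (f₁ : K₂min φ) (f₂ : K₁max φ),
        blockD (adj V) (H.col f₁ f₂) =
          H.col (P₂ φ (M₁.adjoint ((f₁ : HardySpace) + (f₂ : HardySpace))))
            (P₁ φ (M₂.adjoint ((f₁ : HardySpace) + (f₂ : HardySpace))))) := by
  refine ⟨?_, existsUnique_lurkingIsometry hφ, fun Φ V hΦ hV => ?_⟩
  · obtain ⟨M, hM⟩ := hφ.exists_mul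
    -- φ is the image of the constant function 1 under multiplication by φ.
    exact ⟨M (monomial (0, 0)), fun z => by simp [hM, monomial_apply]⟩
  have hx : ∀ x : ℂ, adj V (ColumnSpace.col x (H.col 0 0)) =
      ColumnSpace.col (φ (0, 0) * x)
        (x • H.col (P₂ φ (M₁.adjoint Φ)) (P₁ φ (M₂.adjoint Φ))) := fun x => by
    rw [hV.adj_col hΦ]
    simp only [ZeroMemClass.coe_zero, add_zero, map_smul, RKHS.coe_zero, Pi.zero_apply]
    rfl
  have hf : ∀ (f₁ : K₂min φ) (f₂ : K₁max φ), adj V (ColumnSpace.col 0 (H.col f₁ f₂)) =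
      ColumnSpace.col (((f₁ : HardySpace) + (f₂ : HardySpace)) (0 : Bidisk))
        (H.col (P₂ φ (M₁.adjoint ((f₁ : HardySpace) + (f₂ : HardySpace))))
          (P₁ φ (M₂.adjoint ((f₁ : HardySpace) + (f₂ : HardySpace))))) := fun f₁ f₂ => by
    rw [hV.adj_col hΦ, mul_zero, zero_add, zero_smul, zero_add]
  refine ⟨fun z => ⟨isUnit_one_sub_Ez_mul_blockD V z, hV.realization z⟩, fun x => ?_,
    fun f₁ f₂ => ?_, fun x => ?_, fun f₁ f₂ => ?_⟩
  · exact congrArg WithLp.fst (hx x)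
  · exact congrArg WithLp.fst (hf f₁ f₂)
  · exact congrArg WithLp.snd (hx x)
  · exact congrArg WithLp.snd (hf f₁ f₂)
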